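/- **Theorem 2.1.** Let $k\in\mathbb R$ and let $M$ be the complete simply connected oriented surface of constant curvature $k$: the Euclidean plane $\mathbb E^2$ if $k=0$, the round sphere $\mathbb S^2$ of radius $1/\sqrt k$ if $k>0$, the hyperbolic plane $\mathbb H^2$ of curvature $k$ if $k<0$. Let $O\in M$ be any point and let $(\rho,\theta)$ be geodesic polar coordinates about $O$, so that $\rho$ is the geodesic distance from $O$ and $\theta$ is the polar angle in the tangent plane at $O$, measured counterclockwise. Let $L(\rho)$ and $A(\rho)$ be the circumference and the area of a geodesic disk of radius $\rho$ in $M$, and put $\ell(\rho)=L(\rho)/2\pi$, $a(\rho)=A(\rho)/2\pi$. (i) Let $K\subset M$ be a compact region with $C^2$ boundary. Let $s$ be arc length along $\partial K$, traversed in the positive direction (with $K$ on the left), let $T$ be the unit tangent vector and $T_\perp$ its counterclockwise rotation by $90^\circ$, and let $\kappa_g=\langle \nabla_T T, T_\perp\rangle$ be the geodesic curvature of $\partial K$. Then the perimeter $\mathcal P$ of $K$, that is, the length of $\partial K$, is finite, and $$\mathcal P=\int_{\partial K}\ell(\rho)^2\,\kappa_g\,d\theta+k\int_{\partial K}a(\rho)\,ds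 .$$ No convexity of $K$ is assumed. (ii) The same formula, with integrals along the curve, gives the length of every regular closed $C^2$ curve in $M$, simple or not. Here $\partial K$ and the curve may pass through $O$ and, if $k>0$, through the antipode of $O$; the form $\ell(\rho)^2\,d\theta$ extends smoothly by $0$ to these points. -/

import Mathlib

open Set Filter Topology MeasureTheory

noncomputable section

namespace PlaneGeometry

/-! ### The planes of constant curvature

For every real `k` the simply connected surface of constant curvature `k` is realised in `ℝ³`, with
coordinates `(x₀, x₁, x₂)`:
* `k > 0`: the sphere `x₀² + x₁² + x₂² = 1 / k` in Euclidean space;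
* `k = 0`: the plane `x₀ = 0` in Euclidean space;
* `k < 0`: the hyperboloid sheet `-x₀² + x₁² + x₂² = 1 / k`, `x₀ > 0`, in Minkowski space.
-/

/-- The ambient vector space `ℝ³`. Its norm is only used to speak of differentiability. -/
abbrev Ambient : Type := Fin 3 → ℝ

/-- The ambient bilinear form: the Euclidean inner product for `k ≥ 0` and the Minkowski form
`-v₀ w₀ + v₁ w₁ + v₂ w₂` for `k < 0`. On tangent vectors of the surface it is the Riemannian
metric. -/
def form (k : ℝ) (v w : Ambient) : ℝ :=
  (if k < 0 then -1 else 1) * (v 0 * w 0) + v 1 * w 1 + v 2 * w 2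

/-- The equation of the surface of curvature `k`. -/
def IsPoint (k : ℝ) (p : Ambient) : Prop :=
  if k = 0 then p 0 = 0 else k * form k p p = 1 ∧ (k < 0 → 0 < p 0)

/-- The plane `M` of constant curvature `k`: a round sphere of radius `1 / √k` for `k > 0`, the
Euclidean plane for `k = 0`, a hyperbolic plane for `k < 0`. -/
@[ext]
structure Plane (k : ℝ) : Type where
  /-- the position in the ambient space -/
  val : Ambient
  isPoint : IsPoint k val

/-- The geodesic distance of the surface of curvature `k`, in terms of ambient positions. -/
def geodesicDist (k : ℝ) (p q : Ambient) : ℝ :=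
  if 0 < k then Real.arccos (k * form k p q) / √k
  else if k < 0 then Real.arcosh (k * form k p q) / √(-k)
  else √(form k (p - q) (p - q))

theorem form_comm (k : ℝ) (v w : Ambient) : form k v w = form k w v := by
  unfold form; ring

theorem geodesicDist_comm (k : ℝ) (p q : Ambient) : geodesicDist k p q = geodesicDist k q p := by
  unfold geodesicDist
  rw [form_comm k p q]
  have : form k (p - q) (p - q) = form k (q - p) (q - p) := by
    simp only [form, Pi.sub_apply]; ring
  rw [this]

theorem gram_pos {k : ℝ} (hk : 0 < k) {p q r : Ambient} (hp : k * form k p p = 1)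
    (hq : k * form k q q = 1) (hr : k * form k r r = 1) :
    (k * form k p r - k * form k p q * (k * form k q r)) ^ 2 ≤
      (1 - (k * form k p q) ^ 2) * (1 - (k * form k q r) ^ 2) := by
  have h : (k * form k p p) * (k * form k q q) * (k * form k r r)
      + 2 * (k * form k p r) * (k * form k p q) * (k * form k q r)
      - (k * form k p p) * (k * form k q r) ^ 2 - (k * form k q q) * (k * form k p r) ^ 2
      - (k * form k r r) * (k * form k p q) ^ 2
      = k ^ 3 * (p 0 * (q 1 * r 2 - q 2 * r 1) - p 1 * (q 0 * r 2 - q 2 * r 0)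
          + p 2 * (q 0 * r 1 - q 1 * r 0)) ^ 2 := by
    simp only [form, if_neg (not_lt.2 hk.le)]; ring
  have h0 : 0 ≤ k ^ 3 * (p 0 * (q 1 * r 2 - q 2 * r 1) - p 1 * (q 0 * r 2 - q 2 * r 0)
          + p 2 * (q 0 * r 1 - q 1 * r 0)) ^ 2 := by positivity
  rw [← h, hp, hq, hr] at h0
  linarith

theorem gram_neg {k : ℝ} (hk : k < 0) {p q r : Ambient} (hp : k * form k p p = 1)
    (hq : k * form k q q = 1) (hr : k * form k r r = 1) :
    (k * form k p r - k * form k p q * (k * form k q r)) ^ 2 ≤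
      ((k * form k p q) ^ 2 - 1) * ((k * form k q r) ^ 2 - 1) := by
  have h : (k * form k p p) * (k * form k q q) * (k * form k r r)
      + 2 * (k * form k p r) * (k * form k p q) * (k * form k q r)
      - (k * form k p p) * (k * form k q r) ^ 2 - (k * form k q q) * (k * form k p r) ^ 2
      - (k * form k r r) * (k * form k p q) ^ 2
      = (-k) ^ 3 * (p 0 * (q 1 * r 2 - q 2 * r 1) - p 1 * (q 0 * r 2 - q 2 * r 0)
          + p 2 * (q 0 * r 1 - q 1 * r 0)) ^ 2 := by
    simp only [form, if_pos hk]; ring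
  have hk' : 0 < -k := by linarith
  have h0 : 0 ≤ (-k) ^ 3 * (p 0 * (q 1 * r 2 - q 2 * r 1) - p 1 * (q 0 * r 2 - q 2 * r 0)
          + p 2 * (q 0 * r 1 - q 1 * r 0)) ^ 2 := by positivity
  rw [← h, hp, hq, hr] at h0
  linarith

theorem abs_form_le_one {k : ℝ} (hk : 0 < k) {p q : Ambient} (hp : k * form k p p = 1)
    (hq : k * form k q q = 1) : |k * form k p q| ≤ 1 := by
  have key : k * form k p p * (k * form k q q) - (k * form k p q) ^ 2
      = k ^ 2 * ((p 0 * q 1 - p 1 * q 0) ^ 2 + (p 0 * q 2 - p 2 * q 0) ^ 2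
        + (p 1 * q 2 - p 2 * q 1) ^ 2) := by
    simp only [form, if_neg (not_lt.2 hk.le)]; ring
  rw [hp, hq] at key
  have : 0 ≤ k ^ 2 * ((p 0 * q 1 - p 1 * q 0) ^ 2 + (p 0 * q 2 - p 2 * q 0) ^ 2
        + (p 1 * q 2 - p 2 * q 1) ^ 2) := by positivity
  exact abs_le_of_sq_le_sq (by linarith) (by norm_num)

theorem one_le_form {k : ℝ} (hk : k < 0) {p q : Ambient} (hp : k * form k p p = 1)
    (hq : k * form k q q = 1) (hp0 : 0 < p 0) (hq0 : 0 < q 0) : 1 ≤ k * form k p q := by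
  simp only [form, if_pos hk] at *
  have hk' : 0 < -k := by linarith
  have h1 : 0 < p 0 * q 0 := by positivity
  have e : ((-k) * (p 0 * q 0)) ^ 2 - (1 + (-k) * (p 1 * q 1 + p 2 * q 2)) ^ 2
      = (-k) * ((p 1 - q 1) ^ 2 + (p 2 - q 2) ^ 2) + (-k) ^ 2 * (p 1 * q 2 - p 2 * q 1) ^ 2 := by
    have a1 : (-k) * p 0 ^ 2 = 1 + (-k) * (p 1 ^ 2 + p 2 ^ 2) := by linarith
    have a2 : (-k) * q 0 ^ 2 = 1 + (-k) * (q 1 ^ 2 + q 2 ^ 2) := by linarith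
    have a3 : ((-k) * (p 0 * q 0)) ^ 2 = ((-k) * p 0 ^ 2) * ((-k) * q 0 ^ 2) := by ring
    rw [a3, a1, a2]; ring
  have e2 : 0 ≤ (-k) * ((p 1 - q 1) ^ 2 + (p 2 - q 2) ^ 2)
      + (-k) ^ 2 * (p 1 * q 2 - p 2 * q 1) ^ 2 := by positivity
  have h2 : 0 ≤ (-k) * (p 0 * q 0) := by positivity
  have h3 := abs_le_of_sq_le_sq (by linarith :
    (1 + (-k) * (p 1 * q 1 + p 2 * q 2)) ^ 2 ≤ ((-k) * (p 0 * q 0)) ^ 2) h2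
  linarith [(abs_le.1 h3).2]

theorem geodesicDist_self {k : ℝ} {p : Ambient} (hp : IsPoint k p) : geodesicDist k p p = 0 := by
  unfold geodesicDist IsPoint at *
  split_ifs with h1 h2
  · rw [if_neg h1.ne'] at hp; simp [hp.1]
  · rw [if_neg h2.ne] at hp; simp [hp.1, Real.arcosh]
  · simp [form]

theorem geodesicDist_triangle {k : ℝ} {p q r : Ambient} (hp : IsPoint k p) (hq : IsPoint k q)
    (hr : IsPoint k r) : geodesicDist k p r ≤ geodesicDist k p q + geodesicDist k q r := by
  unfold geodesicDist IsPoint at *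
  split_ifs with h1 h2
  · rw [if_neg h1.ne'] at hp hq hr
    rw [← add_div]
    gcongr
    set v := k * form k p q with hv
    set w := k * form k q r with hw
    set u := k * form k p r with hu
    have bv := abs_le.1 (abs_form_le_one h1 hp.1 hq.1)
    have bw := abs_le.1 (abs_form_le_one h1 hq.1 hr.1)
    have bu := abs_le.1 (abs_form_le_one h1 hp.1 hr.1)
    rw [← hv] at bv
    rw [← hw] at bw
    rw [← hu] at bu
    by_cases hpi : Real.arccos v + Real.arccos w ≤ Real.pi
    · have hcos : Real.cos (Real.arccos v + Real.arccos w) ≤ u := by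
        rw [Real.cos_add, Real.cos_arccos bv.1 bv.2, Real.cos_arccos bw.1 bw.2,
          Real.sin_arccos, Real.sin_arccos, ← Real.sqrt_mul (by nlinarith)]
        have := Real.abs_le_sqrt (gram_pos h1 hp.1 hq.1 hr.1)
        rw [← hv, ← hw, ← hu] at this
        linarith [(abs_le.1 this).1]
      calc Real.arccos u ≤ Real.arccos (Real.cos (Real.arccos v + Real.arccos w)) :=
            Real.arccos_le_arccos hcos
        _ = _ := Real.arccos_cos (add_nonneg (Real.arccos_nonneg _) (Real.arccos_nonneg _)) hpi
    · exact (Real.arccos_le_pi u).trans (not_le.1 hpi).le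
  · rw [if_neg h2.ne] at hp hq hr
    rw [← add_div]
    gcongr
    have bv := one_le_form h2 hp.1 hq.1 (hp.2 h2) (hq.2 h2)
    have bw := one_le_form h2 hq.1 hr.1 (hq.2 h2) (hr.2 h2)
    have bu := one_le_form h2 hp.1 hr.1 (hp.2 h2) (hr.2 h2)
    have hg := gram_neg h2 hp.1 hq.1 hr.1
    set v := k * form k p q
    set w := k * form k q r
    set u := k * form k p r
    have hcosh : u ≤ Real.cosh (Real.arcosh v + Real.arcosh w) := by
      rw [Real.cosh_add, Real.cosh_arcosh bv, Real.cosh_arcosh bw, Real.sinh_arcosh bv,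
        Real.sinh_arcosh bw, ← Real.sqrt_mul (by nlinarith)]
      linarith [(abs_le.1 (Real.abs_le_sqrt hg)).2]
    calc Real.arcosh u ≤ Real.arcosh (Real.cosh (Real.arcosh v + Real.arcosh w)) :=
          (Real.arcosh_le_arcosh (by linarith) (Real.cosh_pos _)).2 hcosh
      _ = _ := Real.arcosh_cosh (add_nonneg (Real.arcosh_nonneg bv) (Real.arcosh_nonneg bw))
  · have hk : k = 0 := le_antisymm (not_lt.1 h1) (not_lt.1 h2)
    have key : ∀ x : Ambient, form k x x = ‖(WithLp.toLp 2 x : EuclideanSpace ℝ (Fin 3))‖ ^ 2 := by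
      intro x
      rw [EuclideanSpace.norm_sq_eq, Fin.sum_univ_three]
      simp only [form, hk, lt_irrefl, if_false, Real.norm_eq_abs, sq_abs]
      ring
    simp only [key, Real.sqrt_sq (norm_nonneg _), WithLp.toLp_sub]
    exact norm_sub_le_norm_sub_add_norm_sub _ _ _

theorem eq_of_geodesicDist_eq_zero {k : ℝ} {p q : Ambient} (hp : IsPoint k p) (hq : IsPoint k q)
    (h : geodesicDist k p q = 0) : p = q := by
  unfold geodesicDist IsPoint at *
  split_ifs at h with h1 h2
  · rw [if_neg h1.ne'] at hp hq
    have h3 : 1 ≤ k * form k p q := by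
      rcases div_eq_zero_iff.1 h with h | h
      · exact Real.arccos_eq_zero.1 h
      · exact absurd h (Real.sqrt_pos.2 h1).ne'
    have h4 : k * ((p 0 - q 0) ^ 2 + (p 1 - q 1) ^ 2 + (p 2 - q 2) ^ 2) ≤ 0 := by
      have := hp.1
      have := hq.1
      simp only [form, if_neg (not_lt.2 h1.le)] at *
      linarith
    have h5 : (p 0 - q 0) ^ 2 + (p 1 - q 1) ^ 2 + (p 2 - q 2) ^ 2 ≤ 0 := by
      by_contra hc
      exact absurd h4 (not_le.2 (mul_pos h1 (not_le.1 hc)))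
    funext i
    fin_cases i <;> simp <;> nlinarith [sq_nonneg (p 0 - q 0), sq_nonneg (p 1 - q 1),
      sq_nonneg (p 2 - q 2)]
  · rw [if_neg h2.ne] at hp hq
    have h3 : k * form k p q = 1 := by
      rcases div_eq_zero_iff.1 h with h | h
      · exact (Real.arcosh_eq_zero_iff
          (one_le_form h2 hp.1 hq.1 (hp.2 h2) (hq.2 h2))).1 h
      · exact absurd h (Real.sqrt_pos.2 (neg_pos.2 h2)).ne'
    obtain ⟨hp1, hp0⟩ := hp
    obtain ⟨hq1, hq0⟩ := hq
    replace hp0 := hp0 h2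
    replace hq0 := hq0 h2
    simp only [form, if_pos h2] at hp1 hq1 h3
    have hk' : 0 < -k := by linarith
    have e : (-k) * ((p 1 - q 1) ^ 2 + (p 2 - q 2) ^ 2)
        + (-k) ^ 2 * (p 1 * q 2 - p 2 * q 1) ^ 2 = 0 := by
      have a1 : (-k) * p 0 ^ 2 = 1 + (-k) * (p 1 ^ 2 + p 2 ^ 2) := by linarith
      have a2 : (-k) * q 0 ^ 2 = 1 + (-k) * (q 1 ^ 2 + q 2 ^ 2) := by linarith
      have a3 : (-k) * (p 0 * q 0) = 1 + (-k) * (p 1 * q 1 + p 2 * q 2) := by linarith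
      have a4 : ((-k) * (p 0 * q 0)) ^ 2 = ((-k) * p 0 ^ 2) * ((-k) * q 0 ^ 2) := by ring
      rw [a1, a2, a3] at a4
      linear_combination -a4
    have e2 : 0 ≤ (-k) ^ 2 * (p 1 * q 2 - p 2 * q 1) ^ 2 := by positivity
    have h5 : (p 1 - q 1) ^ 2 + (p 2 - q 2) ^ 2 ≤ 0 := by
      by_contra hc
      have := mul_pos hk' (not_le.1 hc)
      linarith
    have i1 : p 1 = q 1 := by nlinarith [sq_nonneg (p 1 - q 1), sq_nonneg (p 2 - q 2)]
    have i2 : p 2 = q 2 := by nlinarith [sq_nonneg (p 1 - q 1), sq_nonneg (p 2 - q 2)]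
    have i0 : p 0 = q 0 := by
      have : k * ((p 0 - q 0) * (p 0 + q 0)) = 0 := by
        rw [i1, i2] at hp1
        linarith
      rcases mul_eq_zero.1 this with h | h
      · exact absurd h h2.ne
      · rcases mul_eq_zero.1 h with h | h <;> linarith
    funext i
    fin_cases i <;> simpa
  · have hk : k = 0 := le_antisymm (not_lt.1 h1) (not_lt.1 h2)
    simp only [form, hk, lt_irrefl, if_false, Pi.sub_apply] at h
    have h0 : 0 ≤ 1 * ((p 0 - q 0) * (p 0 - q 0)) + (p 1 - q 1) * (p 1 - q 1)
        + (p 2 - q 2) * (p 2 - q 2) := by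
      linarith [mul_self_nonneg (p 0 - q 0), mul_self_nonneg (p 1 - q 1),
        mul_self_nonneg (p 2 - q 2)]
    rw [Real.sqrt_eq_zero h0] at h
    funext i
    fin_cases i <;> simp <;> nlinarith [mul_self_nonneg (p 0 - q 0),
      mul_self_nonneg (p 1 - q 1), mul_self_nonneg (p 2 - q 2)]

/-- The plane of curvature `k` as a metric space, with its geodesic distance. -/
instance (k : ℝ) : MetricSpace (Plane k) where
  dist p q := geodesicDist k p.val q.val
  dist_self p := geodesicDist_self p.isPoint
  dist_comm p q := geodesicDist_comm k p.val q.val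
  dist_triangle p q r := geodesicDist_triangle p.isPoint q.isPoint r.isPoint
  eq_of_dist_eq_zero {p q} h := Plane.ext (eq_of_geodesicDist_eq_zero p.isPoint q.isPoint h)

instance (k : ℝ) : MeasurableSpace (Plane k) := borel (Plane k)

instance (k : ℝ) : BorelSpace (Plane k) := ⟨rfl⟩

/-! ### Tangent vectors, area form, geodesic curvature -/

/-- `v` is tangent to the surface at `p`. -/
def IsTangent {k : ℝ} (p : Plane k) (v : Ambient) : Prop :=
  if k = 0 then v 0 = 0 else form k p.val v = 0

/-- The length of a tangent vector. -/
def length (k : ℝ) (v : Ambient) : ℝ := √(form k v v)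

/-- The unit normal of the surface in the ambient space (the outward one on the sphere); it fixes
the orientation of the surface. -/
def unitNormal {k : ℝ} (p : Plane k) : Ambient :=
  if k = 0 then ![1, 0, 0] else √|k| • p.val

/-- The Riemannian area form `ω_p(v, w) = det (n_p, v, w)` on tangent vectors at `p`. It equals
`⟨J v, w⟩`, where `J` is the counterclockwise rotation by 90° in the tangent plane. -/
def areaForm {k : ℝ} (p : Plane k) (v w : Ambient) : ℝ :=
  Matrix.det (Matrix.of ![unitNormal p, v, w])

/-- The velocity of a curve in the surface. -/
def velocity {k : ℝ} (γ : ℝ → Plane k) (t : ℝ) : Ambient := deriv (fun s => (γ s).val) t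

/-- The ambient acceleration of a curve in the surface. Its tangential part is the covariant
derivative of the velocity along the curve, its other part is normal to the surface. -/
def acceleration {k : ℝ} (γ : ℝ → Plane k) (t : ℝ) : Ambient := deriv (velocity γ) t

/-- The geodesic curvature `⟨J γ', ∇_{γ'} γ'⟩ / |γ'|³` of a regular curve; for unit speed this is
`⟨J T, ∇_T T⟩`. The area form does not see the normal part of the acceleration, so the latter can
stand in for the covariant derivative. -/
def geodesicCurvature {k : ℝ} (γ : ℝ → Plane k) (t : ℝ) : ℝ :=
  areaForm (γ t) (velocity γ t) (acceleration γ t) / length k (velocity γ t) ^ 3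

/-! ### Polar coordinates -/

/-- A positively oriented orthonormal basis of the tangent plane at `O`. -/
structure Frame {k : ℝ} (O : Plane k) where
  e₁ : Ambient
  e₂ : Ambient
  tangent₁ : IsTangent O e₁
  tangent₂ : IsTangent O e₂
  unit₁ : form k e₁ e₁ = 1
  unit₂ : form k e₂ e₂ = 1
  orthogonal : form k e₁ e₂ = 0
  oriented : areaForm O e₁ e₂ = 1

/-- `cos (√k r)`, `1`, `cosh (√(-k) r)` according to the sign of `k`. -/
def gcos (k r : ℝ) : ℝ :=
  if 0 < k then Real.cos (√k * r) else if k < 0 then Real.cosh (√(-k) * r) else 1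

/-- `sin (√k r) / √k`, `r`, `sinh (√(-k) r) / √(-k)` according to the sign of `k`. -/
def gsin (k r : ℝ) : ℝ :=
  if 0 < k then Real.sin (√k * r) / √k else if k < 0 then Real.sinh (√(-k) * r) / √(-k) else r

variable {k : ℝ} {O : Plane k}

/-- The point with polar coordinates `(r, θ)`: the end of the geodesic of length `r` that leaves
`O` in the direction `cos θ e₁ + sin θ e₂`. -/
def Frame.polar (F : Frame O) (r θ : ℝ) : Ambient :=
  gcos k r • O.val + gsin k r • (Real.cos θ • F.e₁ + Real.sin θ • F.e₂)

theorem Frame.polar_isPoint (F : Frame O) (r θ : ℝ) : IsPoint k (F.polar r θ) := by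
  have hO := O.isPoint
  obtain ⟨e₁, e₂, t1, t2, u1, u2, u12, _⟩ := F
  have hexp : ∀ a b c d : ℝ, form k (a • O.val + b • (c • e₁ + d • e₂))
      (a • O.val + b • (c • e₁ + d • e₂)) = a ^ 2 * form k O.val O.val
        + 2 * a * b * c * form k O.val e₁ + 2 * a * b * d * form k O.val e₂
        + b ^ 2 * (c ^ 2 * form k e₁ e₁ + 2 * c * d * form k e₁ e₂ + d ^ 2 * form k e₂ e₂) := by
    intro a b c d
    simp only [form, Pi.add_apply, Pi.smul_apply, smul_eq_mul]; ring
  unfold IsTangent at t1 t2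
  unfold IsPoint at hO ⊢
  simp only [Frame.polar]
  split_ifs at hO t1 t2 ⊢ with hk
  · simp [hO, t1, t2]
  · have hmain : k * form k (gcos k r • O.val + gsin k r • (Real.cos θ • e₁ + Real.sin θ • e₂))
        (gcos k r • O.val + gsin k r • (Real.cos θ • e₁ + Real.sin θ • e₂)) = 1 := by
      rw [hexp, t1, t2, u1, u2, u12]
      have hgs : gcos k r ^ 2 + k * gsin k r ^ 2 = 1 := by
        unfold gcos gsin
        split_ifs with h1 h2
        · rw [div_pow, Real.sq_sqrt h1.le]
          field_simp
          linarith [Real.sin_sq_add_cos_sq (√k * r)]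
        · rw [div_pow, Real.sq_sqrt (by linarith)]
          field_simp
          linarith [Real.cosh_sq (√(-k) * r)]
        · exact absurd (le_antisymm (not_lt.1 h1) (not_lt.1 h2)) hk
      have := Real.sin_sq_add_cos_sq θ
      linear_combination gcos k r ^ 2 * hO.1 + k * gsin k r ^ 2 * this + hgs
    refine ⟨hmain, fun h => ?_⟩
    -- on the hyperboloid the time coordinate keeps its sign: compare with `O`
    have hO0 := hO.2 h
    have h0 : ¬ 0 < k := not_lt.2 h.le
    set P := gcos k r • O.val + gsin k r • (Real.cos θ • e₁ + Real.sin θ • e₂) with hP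
    have hOP : k * form k O.val P = gcos k r := by
      have : form k O.val P = gcos k r * form k O.val O.val + gsin k r *
          (Real.cos θ * form k O.val e₁ + Real.sin θ * form k O.val e₂) := by
        simp only [hP, form, Pi.add_apply, Pi.smul_apply, smul_eq_mul]; ring
      rw [this, t1, t2]
      linear_combination gcos k r * hO.1
    have hc : 0 < gcos k r := by
      unfold gcos; rw [if_neg h0, if_pos h]; exact Real.cosh_pos _
    by_contra hneg
    have hP0 : P 0 < 0 := by
      refine lt_of_le_of_ne (not_lt.1 hneg) fun hz => ?_
      have := hmain
      simp only [form, if_pos h, hz] at this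
      nlinarith [mul_self_nonneg (P 1), mul_self_nonneg (P 2)]
    have h1 : 1 ≤ k * form k O.val (-P) := by
      refine one_le_form h hO.1 ?_ hO0 (by simpa using hP0)
      have : form k (-P) (-P) = form k P P := by simp [form]
      rw [this]; exact hmain
    have h2 : form k O.val (-P) = - form k O.val P := by
      simp only [form, Pi.neg_apply]; ring
    rw [h2] at h1
    linarith

/-- The point of the surface with polar coordinates `(r, θ)`. -/
def Frame.point (F : Frame O) (r θ : ℝ) : Plane k := ⟨F.polar r θ, F.polar_isPoint r θ⟩

/-- The polar coordinate `ρ` of `p`: its geodesic distance from `O`. -/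
def radius (O p : Plane k) : ℝ := dist O p

/-- The 1-form `dθ = (x dy - y dx) / (x² + y²)` of the polar angle, evaluated at the tangent vector
`v` at `p`. Here `x` and `y` are the components of `p - O` along `e₁` and `e₂`; at the point with
polar coordinates `(r, θ)` they are `gsin k r * cos θ` and `gsin k r * sin θ`. Where the polar angle
is undefined, at `O` and (on a sphere) at the antipode of `O`, the value is `0`. -/
def Frame.dTheta (F : Frame O) (p : Plane k) (v : Ambient) : ℝ :=
  (form k (p.val - O.val) F.e₁ * form k v F.e₂ - form k (p.val - O.val) F.e₂ * form k v F.e₁) /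
    (form k (p.val - O.val) F.e₁ ^ 2 + form k (p.val - O.val) F.e₂ ^ 2)

/-- The circumference `L(ρ)` of a disk of radius `ρ`: the length of `θ ↦ (ρ, θ)`,
`0 ≤ θ ≤ 2π`. -/
def Frame.circumference (F : Frame O) (ρ : ℝ) : ℝ :=
  ∫ θ in (0 : ℝ)..2 * Real.pi, length k (deriv (fun s => F.polar ρ s) θ)

/-- The area `A(ρ)` of a disk of radius `ρ`: the integral of the area element of the surface over
`0 ≤ r ≤ ρ`, `0 ≤ θ ≤ 2π` in polar coordinates. -/
def Frame.diskArea (F : Frame O) (ρ : ℝ) : ℝ :=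
  ∫ r in (0 : ℝ)..ρ, ∫ θ in (0 : ℝ)..2 * Real.pi,
    |areaForm (F.point r θ) (deriv (fun s => F.polar s θ) r) (deriv (fun s => F.polar r s) θ)|

/-- The normalized circumference `ℓ(ρ) = L(ρ) / 2π`. -/
def Frame.ell (F : Frame O) (ρ : ℝ) : ℝ := F.circumference ρ / (2 * Real.pi)

/-- The normalized area `a(ρ) = A(ρ) / 2π`. -/
def Frame.normArea (F : Frame O) (ρ : ℝ) : ℝ := F.diskArea ρ / (2 * Real.pi)

/-! ### Regions with `C²` boundary -/

/-- `f` is a `C²` function that defines `K` near `p` as `{f ≤ 0}`, and whose differential does not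
vanish on the tangent plane at `p`. -/
def IsLocalDefiningFunction (K : Set (Plane k)) (p : Plane k) (f : Ambient → ℝ) : Prop :=
  ContDiffAt ℝ 2 f p.val ∧ (∃ v, IsTangent p v ∧ fderiv ℝ f p.val v ≠ 0) ∧
    ∀ᶠ q in 𝓝 p, q ∈ K ↔ f q.val ≤ 0

/-- `K` has `C²` boundary. -/
def HasC2Boundary (K : Set (Plane k)) : Prop :=
  ∀ p ∈ frontier K, ∃ f, IsLocalDefiningFunction K p f

/-- `γ`, near the parameter `0`, is a regular `C²` parametrization of the boundary of `K` through
`p = γ 0`, in the positive direction: tangent vectors at `p` to the left of `γ'` point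
into `K`. -/
def IsBoundaryArc (K : Set (Plane k)) (p : Plane k) (γ : ℝ → Plane k) : Prop :=
  γ 0 = p ∧ ContDiffAt ℝ 2 (fun t => (γ t).val) 0 ∧ velocity γ 0 ≠ 0 ∧
    (∀ᶠ t in 𝓝 0, γ t ∈ frontier K) ∧
    ∃ f, IsLocalDefiningFunction K p f ∧
      ∀ v, IsTangent p v → 0 < areaForm p (velocity γ 0) v → fderiv ℝ f p.val v < 0

open Classical in
/-- A positively directed local parametrization of the boundary of `K` near `p` (a constant curve
if there is none, which does not happen at boundary points of a set with `C²` boundary). -/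
def boundaryArc (K : Set (Plane k)) (p : Plane k) : ℝ → Plane k :=
  if h : ∃ γ, IsBoundaryArc K p γ then h.choose else fun _ => p

/-- The unit tangent `T` of the boundary of `K`, in the positive direction. -/
def boundaryTangent (K : Set (Plane k)) (p : Plane k) : Ambient :=
  (length k (velocity (boundaryArc K p) 0))⁻¹ • velocity (boundaryArc K p) 0

/-- The geodesic curvature `κ_g` of the positively directed boundary of `K`. -/
def boundaryCurvature (K : Set (Plane k)) (p : Plane k) : ℝ :=
  geodesicCurvature (boundaryArc K p) 0

/-- Arc length `ds` as a measure on the surface: one-dimensional Hausdorff measure for the geodesic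
distance. -/
def arcLength (k : ℝ) : Measure (Plane k) := μH[1]

end PlaneGeometry

end

open PlaneGeometry

namespace PlaneGeometry

variable {k : ℝ} {O p : Plane k}

/-! ### The ambient form -/

/-! The formula is a Minkowski-type identity. On a surface of constant curvature the radial field `X
= gsin ρ ∂_ρ` is closed and conformal: `∇_v X = gcos ρ • v` for every tangent vector `v`. In the
ambient space `X` is the tangential part of `p - O`, so `⟨X, v⟩ = form k (p - O) v`. Along a curve
with unit tangent `T` and rotated tangent `JT`, the arc-length derivative of `⟨X, T⟩` is `gcos ρ +
κ_g ⟨X, JT⟩`, and `⟨X, JT⟩ = -gsin² ρ dθ(T)`. Here `ℓ = |gsin|` (`Frame.ell_eq`), and `gcos' = -k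
gsin` together with `a = ∫ gsin` gives `gcos ρ = 1 - k a(ρ)` (`Frame.one_sub_normArea_radius`).
Hence `d⟨X, T⟩/ds = 1 - k a(ρ) - ℓ(ρ)² κ_g dθ(T)`. This is `Frame.hasDerivAt_form_div_length`, and
its algebra is the Gram determinant computation in `closed_conformal_identity`. The points where `θ`
is undefined do no harm, because `ℓ² dθ(v) = areaForm O (p - O) v` is polynomial in `p` and `v`
(`Frame.ell_sq_mul_dTheta`).

For a closed curve, integration over one period finishes the proof (`Frame.length_closed_curve`).

For a region, arc length is a Hausdorff measure and the boundary has no given parametrization. The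
inverse function theorem supplies local boundary arcs (`nonempty_boundaryChart`). Their metric speed
is the length of the velocity (`tendsto_dist_div`), so Hausdorff measure on an arc is speed times
Lebesgue measure (`restrict_hausdorffMeasure_image`). The tangent and curvature obtained by choosing
a boundary arc at each point agree with those of every chart (`BoundaryChart.boundary_eq`). For a
cutoff `χ` supported in a chart, the derivative of `χ ⟨X, T⟩` has integral zero
(`BoundaryChart.setIntegral_eq_zero`). Summing over a partition of unity removes the cutoffs, with
no need to decompose the boundary into closed curves. -/

/-- The sign of the first coordinate in the ambient form. -/
noncomputable def formSign (k : ℝ) : ℝ := if k < 0 then -1 else 1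

theorem form_def (k : ℝ) (v w : Ambient) :
    form k v w = formSign k * (v 0 * w 0) + v 1 * w 1 + v 2 * w 2 := rfl

theorem formSign_mul_self (k : ℝ) : formSign k * formSign k = 1 := by
  unfold formSign; split_ifs <;> norm_num

theorem formSign_mul_abs (k : ℝ) : formSign k * |k| = k := by
  unfold formSign
  split_ifs with h
  · rw [abs_of_neg h]; ring
  · rw [abs_of_nonneg (not_lt.1 h)]; ring

theorem form_add_left (u v w : Ambient) : form k (u + v) w = form k u w + form k v w := by
  simp only [form_def, Pi.add_apply]; ring

theorem form_add_right (u v w : Ambient) : form k u (v + w) = form k u v + form k u w := by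
  simp only [form_def, Pi.add_apply]; ring

theorem form_sub_left (u v w : Ambient) : form k (u - v) w = form k u w - form k v w := by
  simp only [form_def, Pi.sub_apply]; ring

theorem form_sub_right (u v w : Ambient) : form k u (v - w) = form k u v - form k u w := by
  simp only [form_def, Pi.sub_apply]; ring

theorem form_smul_left (c : ℝ) (v w : Ambient) : form k (c • v) w = c * form k v w := by
  simp only [form_def, Pi.smul_apply, smul_eq_mul]; ring

theorem form_smul_right (c : ℝ) (v w : Ambient) : form k v (c • w) = c * form k v w := by
  simp only [form_def, Pi.smul_apply, smul_eq_mul]; ring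

@[fun_prop]
theorem continuous_form (k : ℝ) : Continuous fun x : Ambient × Ambient => form k x.1 x.2 := by
  unfold form; fun_prop

theorem hasDerivAt_form {u w : ℝ → Ambient} {u' w' : Ambient} {t : ℝ} (hu : HasDerivAt u u' t)
    (hw : HasDerivAt w w' t) :
    HasDerivAt (fun s => form k (u s) (w s)) (form k u' (w t) + form k (u t) w') t := by
  have hu := hasDerivAt_pi.1 hu
  have hw := hasDerivAt_pi.1 hw
  have := ((((hu 0).mul (hw 0)).const_mul (formSign k)).add ((hu 1).mul (hw 1))).add
    ((hu 2).mul (hw 2))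
  refine this.congr_deriv ?_
  simp only [form_def]; ring

/-- The determinant of three ambient vectors. -/
def det₃ (u v w : Ambient) : ℝ :=
  u 0 * (v 1 * w 2 - v 2 * w 1) - u 1 * (v 0 * w 2 - v 2 * w 0) + u 2 * (v 0 * w 1 - v 1 * w 0)

theorem areaForm_eq (p : Plane k) (v w : Ambient) : areaForm p v w = det₃ (unitNormal p) v w := by
  simp only [areaForm, det₃, Matrix.det_fin_three, Matrix.of_apply, Matrix.cons_val_zero,
    Matrix.cons_val_one, Matrix.cons_val]
  ring

/-- Multiplicativity of the determinant: the right-hand side is the Gram determinant of the two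
triples, and `formSign k` is the determinant of the matrix of the form. -/
theorem det₃_mul_det₃ (a b c d e f : Ambient) :
    formSign k * (det₃ a b c * det₃ d e f) =
      form k a d * (form k b e * form k c f - form k b f * form k c e)
      - form k a e * (form k b d * form k c f - form k b f * form k c d)
      + form k a f * (form k b d * form k c e - form k b e * form k c d) := by
  simp only [det₃, form_def]; ring

/-- Cramer's rule in `ℝ³`, multiplied out so that no independence is needed. -/
theorem det₃_smul_eq (n a b u : Ambient) :
    det₃ n a b • u = det₃ u a b • n + det₃ n u b • a + det₃ n a u • b := by
  funext i
  simp only [det₃, Pi.add_apply, Pi.smul_apply, smul_eq_mul]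
  fin_cases i <;> simp <;> ring

theorem unitNormal_of_ne (hk : k ≠ 0) (p : Plane k) : unitNormal p = √|k| • p.val := by
  simp [unitNormal, hk]

theorem mul_form_self (hk : k ≠ 0) (p : Plane k) : k * form k p.val p.val = 1 := by
  have := p.isPoint
  rw [IsPoint, if_neg hk] at this
  exact this.1

theorem form_self_eq (hk : k ≠ 0) (p : Plane k) : form k p.val p.val = 1 / k := by
  rw [eq_div_iff hk, mul_comm]; exact mul_form_self hk p

theorem form_unitNormal_self (p : Plane k) :
    form k (unitNormal p) (unitNormal p) = formSign k := by
  by_cases hk : k = 0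
  · subst hk
    simp [unitNormal, form_def]
  · rw [unitNormal_of_ne hk, form_smul_left, form_smul_right, ← mul_assoc,
      Real.mul_self_sqrt (abs_nonneg k), form_self_eq hk]
    nth_rewrite 2 [← formSign_mul_abs k]
    have : |k| ≠ 0 := abs_ne_zero.2 hk
    have h1 := formSign_mul_self k
    have : formSign k ≠ 0 := fun h => by simp [h] at h1
    field_simp
    linarith

theorem isTangent_iff {v : Ambient} : IsTangent p v ↔ form k (unitNormal p) v = 0 := by
  by_cases hk : k = 0
  · subst hk
    simp [IsTangent, unitNormal, form_def, formSign]
  · rw [IsTangent, if_neg hk, unitNormal_of_ne hk, form_smul_left, mul_eq_zero]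
    have : √|k| ≠ 0 := (Real.sqrt_pos.2 (abs_pos.2 hk)).ne'
    simp [this]

theorem IsTangent.form_eq_zero (hk : k ≠ 0) {v : Ambient} (h : IsTangent p v) :
    form k p.val v = 0 := by
  rwa [IsTangent, if_neg hk] at h

/-- The form is positive definite on tangent planes. -/
theorem IsTangent.sq_le {v : Ambient} (hv : IsTangent p v) :
    v 0 ^ 2 + v 1 ^ 2 + v 2 ^ 2 ≤ (2 * unitNormal p 0 ^ 2 + 1) * form k v v := by
  have h1 := isTangent_iff.1 hv
  have h2 := form_unitNormal_self p
  set n := unitNormal p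
  simp only [form_def] at *
  unfold formSign at *
  split_ifs at * with hk
  -- Hyperbolic case: tangency expresses `n 0 * v 0` through the space coordinates, and
  -- Cauchy–Schwarz with `n 0 ^ 2 - 1 = n 1 ^ 2 + n 2 ^ 2` bounds `v 0`.
  · have e : (n 0 * v 0) ^ 2 = (n 1 * v 1 + n 2 * v 2) ^ 2 := by
      have : n 0 * v 0 = n 1 * v 1 + n 2 * v 2 := by linarith
      rw [this]
    have e1 : n 0 ^ 2 * v 0 ^ 2 ≤ (n 0 ^ 2 - 1) * (v 1 ^ 2 + v 2 ^ 2) := by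
      have : n 0 ^ 2 - 1 = n 1 ^ 2 + n 2 ^ 2 := by linarith
      rw [this]
      nlinarith [sq_nonneg (n 1 * v 2 - n 2 * v 1)]
    have e2 : 1 ≤ n 0 ^ 2 := by nlinarith [sq_nonneg (n 1), sq_nonneg (n 2)]
    have e3 : v 0 ^ 2 ≤ v 1 ^ 2 + v 2 ^ 2 := by
      by_contra hc
      nlinarith [sq_nonneg (v 1), sq_nonneg (v 2)]
    nlinarith
  · nlinarith [sq_nonneg (n 0), sq_nonneg (v 0), sq_nonneg (v 1), sq_nonneg (v 2),
      mul_nonneg (sq_nonneg (n 0)) (add_nonneg (add_nonneg (sq_nonneg (v 0)) (sq_nonneg (v 1)))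
        (sq_nonneg (v 2)))]

theorem IsTangent.form_pos {v : Ambient} (hv : IsTangent p v) (h : v ≠ 0) : 0 < form k v v := by
  by_contra hc
  have h1 := hv.sq_le
  have h2 : (2 * unitNormal p 0 ^ 2 + 1) * form k v v ≤ 0 :=
    mul_nonpos_of_nonneg_of_nonpos (by positivity) (not_lt.1 hc)
  apply h
  funext i
  fin_cases i <;> simp <;> nlinarith [sq_nonneg (v 0), sq_nonneg (v 1), sq_nonneg (v 2)]

theorem IsTangent.add {v w : Ambient} (hv : IsTangent p v) (hw : IsTangent p w) :
    IsTangent p (v + w) := by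
  rw [isTangent_iff] at *; rw [form_add_right, hv, hw, add_zero]

theorem IsTangent.smul {v : Ambient} (hv : IsTangent p v) (c : ℝ) : IsTangent p (c • v) := by
  rw [isTangent_iff] at *; rw [form_smul_right, hv, mul_zero]

theorem IsTangent.length_pos {v : Ambient} (hv : IsTangent p v) (h : v ≠ 0) : 0 < length k v :=
  Real.sqrt_pos.2 (hv.form_pos h)

/-- If the determinant were nonzero, Cramer's rule would write the unit normal as a combination of
tangent vectors; pairing with the normal, which is not null, excludes this. -/
theorem IsTangent.det₃_eq_zero {u v w : Ambient} (hu : IsTangent p u) (hv : IsTangent p v)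
    (hw : IsTangent p w) : det₃ u v w = 0 := by
  rw [isTangent_iff] at *
  have h1 := det₃_smul_eq u v w (unitNormal p)
  have h2 : form k (det₃ u v w • unitNormal p) (unitNormal p) = 0 := by
    rw [h1, form_add_left, form_add_left, form_smul_left, form_smul_left, form_smul_left,
      form_comm k u, form_comm k v, form_comm k w, hu, hv, hw]
    simp
  rw [form_smul_left, form_unitNormal_self] at h2
  rcases mul_eq_zero.1 h2 with h | h
  · exact h
  · have := formSign_mul_self k
    simp [h] at this

/-- Cramer's rule in the tangent plane. -/
theorem IsTangent.areaForm_smul_eq {a b v : Ambient} (ha : IsTangent p a) (hb : IsTangent p b)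
    (hv : IsTangent p v) : areaForm p a b • v = areaForm p v b • a + areaForm p a v • b := by
  simp only [areaForm_eq]
  rw [det₃_smul_eq, hv.det₃_eq_zero ha hb, zero_smul, zero_add]

/-! ### Frames -/

/-- Cramer's rule for the normal and the frame, whose determinant is `1`; the Gram identity turns
each coefficient determinant into an inner product. -/
theorem Frame.eq_sum (F : Frame O) (u : Ambient) :
    u = (formSign k * form k (unitNormal O) u) • unitNormal O + form k u F.e₁ • F.e₁
      + form k u F.e₂ • F.e₂ := by
  have h1 := F.oriented
  rw [areaForm_eq] at h1
  have hs := formSign_mul_self k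
  have t1 := isTangent_iff.1 F.tangent₁
  have t2 := isTangent_iff.1 F.tangent₂
  have nn := form_unitNormal_self O
  have := det₃_smul_eq (unitNormal O) F.e₁ F.e₂ u
  have g1 := det₃_mul_det₃ (k := k) (unitNormal O) F.e₁ F.e₂ u F.e₁ F.e₂
  have g2 := det₃_mul_det₃ (k := k) (unitNormal O) F.e₁ F.e₂ (unitNormal O) u F.e₂
  have g3 := det₃_mul_det₃ (k := k) (unitNormal O) F.e₁ F.e₂ (unitNormal O) F.e₁ u
  rw [h1, F.unit₁, F.unit₂, form_comm k F.e₂ F.e₁, F.orthogonal, t1, t2] at g1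
  rw [h1, nn, F.unit₂, form_comm k F.e₁ (unitNormal O), form_comm k F.e₂ (unitNormal O),
    t1, t2, F.orthogonal] at g2
  rw [h1, nn, F.unit₁, form_comm k F.e₁ (unitNormal O), form_comm k F.e₂ (unitNormal O),
    t1, t2, form_comm k F.e₂ F.e₁, F.orthogonal] at g3
  rw [h1, one_smul] at this
  have s0 : formSign k ≠ 0 := fun h => by simp [h] at hs
  have d1 : det₃ u F.e₁ F.e₂ = formSign k * form k (unitNormal O) u := by
    linear_combination formSign k * g1 - det₃ u F.e₁ F.e₂ * hs
  have d2 : det₃ (unitNormal O) u F.e₂ = form k u F.e₁ := by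
    rw [form_comm k u]; apply mul_left_cancel₀ s0; linarith
  have d3 : det₃ (unitNormal O) F.e₁ u = form k u F.e₂ := by
    rw [form_comm k u]; apply mul_left_cancel₀ s0; linarith
  rw [d1, d2, d3] at this
  exact this

theorem Frame.form_self_eq_sum (F : Frame O) (u : Ambient) :
    form k u u = formSign k * form k (unitNormal O) u ^ 2 + form k u F.e₁ ^ 2
      + form k u F.e₂ ^ 2 := by
  have h : form k u u = form k u ((formSign k * form k (unitNormal O) u) • unitNormal O
      + form k u F.e₁ • F.e₁ + form k u F.e₂ • F.e₂) := by rw [← F.eq_sum u]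
  rw [h]
  simp only [form_add_right, form_smul_right]
  rw [form_comm k u (unitNormal O)]
  ring

theorem Frame.areaForm_eq_sub (F : Frame O) (u v : Ambient) :
    areaForm O u v = form k u F.e₁ * form k v F.e₂ - form k u F.e₂ * form k v F.e₁ := by
  have h1 := F.oriented
  rw [areaForm_eq] at *
  have hs := formSign_mul_self k
  have g := det₃_mul_det₃ (k := k) (unitNormal O) F.e₁ F.e₂ (unitNormal O) u v
  rw [h1, form_unitNormal_self, form_comm k F.e₁ (unitNormal O), form_comm k F.e₂ (unitNormal O),
    isTangent_iff.1 F.tangent₁, isTangent_iff.1 F.tangent₂, form_comm k F.e₁, form_comm k F.e₂,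
    form_comm k F.e₁, form_comm k F.e₂] at g
  have s0 : formSign k ≠ 0 := fun h => by simp [h] at hs
  apply mul_left_cancel₀ s0; linarith

/-! ### Generalized trigonometric functions, circumference and area of disks -/

theorem gcos_sq_add (k r : ℝ) : gcos k r ^ 2 + k * gsin k r ^ 2 = 1 := by
  unfold gcos gsin
  split_ifs with h1 h2
  · rw [div_pow, Real.sq_sqrt h1.le]
    field_simp
    linarith [Real.sin_sq_add_cos_sq (√k * r)]
  · rw [div_pow, Real.sq_sqrt (by linarith)]
    have := h2.ne
    field_simp
    linarith [Real.cosh_sq (√(-k) * r)]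
  · rw [le_antisymm (not_lt.1 h1) (not_lt.1 h2)]; ring

theorem hasDerivAt_gcos (k r : ℝ) : HasDerivAt (gcos k) (-k * gsin k r) r := by
  unfold gcos gsin
  split_ifs with h1 h2
  · have h := ((hasDerivAt_id r).const_mul √k).cos
    refine h.congr_deriv ?_
    have := Real.sqrt_pos.2 h1
    have e := Real.mul_self_sqrt h1.le
    simp only [id, mul_one]
    field_simp
    rw [sq, e]; ring
  · have h := ((hasDerivAt_id r).const_mul √(-k)).cosh
    refine h.congr_deriv ?_
    have := Real.sqrt_pos.2 (neg_pos.2 h2)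
    have e := Real.mul_self_sqrt (neg_pos.2 h2).le
    simp only [id, mul_one]
    field_simp
    rw [sq, e]; ring
  · have : k = 0 := le_antisymm (not_lt.1 h1) (not_lt.1 h2)
    simpa [this] using hasDerivAt_const r (1 : ℝ)

theorem hasDerivAt_gsin (k r : ℝ) : HasDerivAt (gsin k) (gcos k r) r := by
  unfold gcos gsin
  split_ifs with h1 h2
  · have h := ((hasDerivAt_id r).const_mul √k).sin.div_const √k
    refine h.congr_deriv ?_
    have := Real.sqrt_pos.2 h1
    simp only [id, mul_one]
    field_simp
  · have h := ((hasDerivAt_id r).const_mul √(-k)).sinh.div_const √(-k)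
    refine h.congr_deriv ?_
    have := Real.sqrt_pos.2 (neg_pos.2 h2)
    simp only [id, mul_one]
    field_simp
  · exact hasDerivAt_id r

theorem continuous_gcos (k : ℝ) : Continuous (gcos k) :=
  continuous_iff_continuousAt.2 fun r => (hasDerivAt_gcos k r).continuousAt

theorem continuous_gsin (k : ℝ) : Continuous (gsin k) :=
  continuous_iff_continuousAt.2 fun r => (hasDerivAt_gsin k r).continuousAt

theorem gsin_zero (k : ℝ) : gsin k 0 = 0 := by
  unfold gsin; split_ifs <;> simp

theorem gcos_zero (k : ℝ) : gcos k 0 = 1 := by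
  unfold gcos; split_ifs <;> simp

theorem gsin_nonneg {r : ℝ} (hr : 0 ≤ r) (hr' : 0 < k → √k * r ≤ Real.pi) : 0 ≤ gsin k r := by
  unfold gsin
  split_ifs with h1 h2
  · exact div_nonneg (Real.sin_nonneg_of_nonneg_of_le_pi (by positivity) (hr' h1)) (by positivity)
  · exact div_nonneg (Real.sinh_nonneg_iff.2 (by positivity)) (by positivity)
  · exact hr

theorem Frame.hasDerivAt_polar_angle (F : Frame O) (r θ : ℝ) :
    HasDerivAt (fun s => F.polar r s)
      (gsin k r • (-Real.sin θ • F.e₁ + Real.cos θ • F.e₂)) θ := by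
  unfold Frame.polar
  exact ((((Real.hasDerivAt_cos θ).smul_const F.e₁).add
    ((Real.hasDerivAt_sin θ).smul_const F.e₂)).const_smul (gsin k r)).const_add _

theorem Frame.hasDerivAt_polar_radius (F : Frame O) (r θ : ℝ) :
    HasDerivAt (fun s => F.polar s θ)
      ((-k * gsin k r) • O.val + gcos k r • (Real.cos θ • F.e₁ + Real.sin θ • F.e₂)) r := by
  unfold Frame.polar
  exact ((hasDerivAt_gcos k r).smul_const _).add ((hasDerivAt_gsin k r).smul_const _)

theorem Frame.ell_eq (F : Frame O) (ρ : ℝ) : F.ell ρ = |gsin k ρ| := by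
  have h : ∀ θ, length k (deriv (fun s => F.polar ρ s) θ) = |gsin k ρ| := by
    intro θ
    rw [(F.hasDerivAt_polar_angle ρ θ).deriv, length]
    have : form k (gsin k ρ • (-Real.sin θ • F.e₁ + Real.cos θ • F.e₂))
        (gsin k ρ • (-Real.sin θ • F.e₁ + Real.cos θ • F.e₂)) = gsin k ρ ^ 2 := by
      simp only [form_smul_left, form_smul_right, form_add_left, form_add_right, F.unit₁, F.unit₂,
        F.orthogonal, form_comm k F.e₂ F.e₁]
      linear_combination gsin k ρ ^ 2 * Real.sin_sq_add_cos_sq θ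
    rw [this, Real.sqrt_sq_eq_abs]
  have hpi := Real.pi_pos
  simp only [Frame.ell, Frame.circumference, h, intervalIntegral.integral_const, smul_eq_mul]
  field_simp
  ring

/-- For `k ≠ 0` the position and the radial derivative are combinations of `O` and one unit
direction with determinant `gcos ^ 2 + k * gsin ^ 2 = 1`, so only the length `gsin k r` of the
angular derivative survives. -/
theorem Frame.areaForm_polar (F : Frame O) (r θ : ℝ) :
    areaForm (F.point r θ) (deriv (fun s => F.polar s θ) r) (deriv (fun s => F.polar r s) θ)
      = gsin k r := by
  have h1 := F.oriented
  rw [(F.hasDerivAt_polar_angle r θ).deriv, (F.hasDerivAt_polar_radius r θ).deriv]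
  rw [areaForm_eq] at *
  have hsc := Real.sin_sq_add_cos_sq θ
  by_cases hk : k = 0
  · subst hk
    simp only [unitNormal, if_true] at *
    have c1 : gcos 0 r = 1 := by simp [gcos]
    rw [c1]
    simp only [det₃, Pi.add_apply, Pi.smul_apply, smul_eq_mul, Matrix.cons_val_zero,
      Matrix.cons_val_one, Matrix.cons_val] at *
    linear_combination gsin 0 r * h1 +
      gsin 0 r * (F.e₁ 1 * F.e₂ 2 - F.e₁ 2 * F.e₂ 1) * hsc
  · rw [unitNormal_of_ne hk] at *
    have hg := gcos_sq_add k r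
    have e : det₃ (√|k| • (F.point r θ).val)
        ((-k * gsin k r) • O.val + gcos k r • (Real.cos θ • F.e₁ + Real.sin θ • F.e₂))
        (gsin k r • (-Real.sin θ • F.e₁ + Real.cos θ • F.e₂))
        = gsin k r * (gcos k r ^ 2 + k * gsin k r ^ 2) * (Real.sin θ ^ 2 + Real.cos θ ^ 2) *
          det₃ (√|k| • O.val) F.e₁ F.e₂ := by
      simp only [det₃, Frame.point, Frame.polar, Pi.add_apply, Pi.smul_apply, smul_eq_mul]
      ring
    rw [e, h1, hg, hsc]; ring

/-- On a sphere the bound keeps `r` between `O` and its antipode, where `gsin` is nonnegative and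
the absolute value in the area element can be dropped. -/
theorem Frame.normArea_eq (F : Frame O) {ρ : ℝ} (hρ : 0 ≤ ρ)
    (hρ' : 0 < k → √k * ρ ≤ Real.pi) : F.normArea ρ = ∫ r in (0 : ℝ)..ρ, gsin k r := by
  have hpi := Real.pi_pos
  have h : F.diskArea ρ = ∫ r in (0 : ℝ)..ρ, 2 * Real.pi * gsin k r := by
    unfold Frame.diskArea
    refine intervalIntegral.integral_congr fun r hr => ?_
    rw [uIcc_of_le hρ] at hr
    have hs : 0 ≤ gsin k r := gsin_nonneg hr.1 fun hk =>
      (mul_le_mul_of_nonneg_left hr.2 (Real.sqrt_nonneg k)).trans (hρ' hk)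
    simp only [F.areaForm_polar, abs_of_nonneg hs, intervalIntegral.integral_const, smul_eq_mul,
      sub_zero]
  rw [Frame.normArea, h, intervalIntegral.integral_const_mul]
  field_simp

theorem one_sub_mul_integral_gsin (k ρ : ℝ) :
    1 - k * ∫ r in (0 : ℝ)..ρ, gsin k r = gcos k ρ := by
  have h3 : ∫ r in (0 : ℝ)..ρ, -k * gsin k r = gcos k ρ - gcos k 0 :=
    intervalIntegral.integral_eq_sub_of_hasDerivAt (fun r _ => hasDerivAt_gcos k r)
      ((continuous_const.mul (continuous_gsin k)).intervalIntegrable _ _)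
  rw [intervalIntegral.integral_const_mul, gcos_zero] at h3
  linarith

/-! ### The distance from a point -/

theorem dist_eq (p q : Plane k) : dist p q = geodesicDist k p.val q.val := rfl

theorem radius_nonneg (O p : Plane k) : 0 ≤ radius O p := dist_nonneg

theorem sqrt_mul_radius_le (hk : 0 < k) (O p : Plane k) : √k * radius O p ≤ Real.pi := by
  rw [radius, dist_eq, geodesicDist, if_pos hk]
  have := Real.sqrt_pos.2 hk
  rw [mul_div_cancel₀ _ this.ne']
  exact Real.arccos_le_pi _

theorem one_le_mul_form (hk : k < 0) (p q : Plane k) : 1 ≤ k * form k p.val q.val := by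
  have hp := p.isPoint
  have hq := q.isPoint
  rw [IsPoint, if_neg hk.ne] at hp hq
  exact one_le_form hk hp.1 hq.1 (hp.2 hk) (hq.2 hk)

theorem gcos_dist (hk : k ≠ 0) (p q : Plane k) : gcos k (dist p q) = k * form k p.val q.val := by
  rw [dist_eq, geodesicDist, gcos]
  split_ifs with h1 h2
  · have := Real.sqrt_pos.2 h1
    rw [mul_div_cancel₀ _ this.ne']
    have h := abs_le.1 (abs_form_le_one h1 (mul_form_self hk p) (mul_form_self hk q))
    exact Real.cos_arccos h.1 h.2
  · have := Real.sqrt_pos.2 (neg_pos.2 h2)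
    rw [mul_div_cancel₀ _ this.ne', Real.cosh_arcosh (one_le_mul_form h2 p q)]
  · exact absurd (le_antisymm (not_lt.1 h1) (not_lt.1 h2)) hk

theorem form_zero_self_nonneg (v : Ambient) : 0 ≤ form 0 v v := by
  simp only [form, lt_irrefl, if_false]
  nlinarith [mul_self_nonneg (v 0), mul_self_nonneg (v 1), mul_self_nonneg (v 2)]

theorem dist_sq_zero (p q : Plane 0) : dist p q ^ 2 = form 0 (p.val - q.val) (p.val - q.val) := by
  rw [dist_eq, geodesicDist, if_neg (lt_irrefl _), if_neg (lt_irrefl _),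
    Real.sq_sqrt (form_zero_self_nonneg _)]

theorem form_sub_self (hk : k ≠ 0) (p q : Plane k) :
    k * form k (p.val - q.val) (p.val - q.val) = 2 - 2 * (k * form k p.val q.val) := by
  rw [form_sub_left, form_sub_right, form_sub_right, form_comm k q.val p.val]
  linarith [mul_form_self hk p, mul_form_self hk q]

theorem val_zero_eq (p : Plane 0) : p.val 0 = 0 := by
  simpa [IsPoint] using p.isPoint

/-- Pythagoras in the frame: the squared length of `p - O` and its normal component are both
determined by `gcos k (radius O p)`, and what remains is `gsin ^ 2`. This identifies the denominator
of `Frame.dTheta` with `ℓ ^ 2`. -/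
theorem Frame.gsin_radius_sq (F : Frame O) (p : Plane k) :
    gsin k (radius O p) ^ 2
      = form k (p.val - O.val) F.e₁ ^ 2 + form k (p.val - O.val) F.e₂ ^ 2 := by
  have hP := F.form_self_eq_sum (p.val - O.val)
  by_cases hk : k = 0
  · subst hk
    have h : form 0 (unitNormal O) (p.val - O.val) = 0 := by
      simp [unitNormal, form_def, val_zero_eq]
    rw [h, form_comm 0 (p.val - O.val) F.e₁, form_comm 0 (p.val - O.val) F.e₂] at hP
    rw [form_comm 0 _ F.e₁, form_comm 0 _ F.e₂]
    have : gsin 0 (radius O p) = radius O p := by simp [gsin]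
    rw [this, radius, dist_comm, dist_sq_zero, hP]
    ring
  · have h1 := gcos_sq_add k (radius O p)
    rw [radius, gcos_dist hk] at h1
    have h2 := form_sub_self hk p O
    have h3 : form k (unitNormal O) (p.val - O.val)
        = √|k| * (form k O.val p.val - 1 / k) := by
      rw [unitNormal_of_ne hk, form_smul_left, form_sub_right, form_self_eq hk]
    rw [h3, mul_pow, Real.sq_sqrt (abs_nonneg k), ← mul_assoc, formSign_mul_abs] at hP
    rw [hP, form_comm k p.val O.val] at h2
    rw [radius]
    apply mul_left_cancel₀ hk
    field_simp at h2
    linarith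

theorem Frame.normArea_radius (F : Frame O) (p : Plane k) :
    F.normArea (radius O p) = ∫ r in (0 : ℝ)..radius O p, gsin k r :=
  F.normArea_eq (radius_nonneg O p) fun hk => sqrt_mul_radius_le hk O p

theorem Frame.one_sub_normArea_radius (F : Frame O) (p : Plane k) :
    1 - k * F.normArea (radius O p) = gcos k (radius O p) := by
  rw [F.normArea_radius, one_sub_mul_integral_gsin]

theorem Frame.continuous_normArea_radius (F : Frame O) :
    Continuous fun p : Plane k => F.normArea (radius O p) := by
  simp only [F.normArea_radius]
  have h : Continuous fun ρ => ∫ r in (0 : ℝ)..ρ, gsin k r :=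
    intervalIntegral.continuous_primitive (fun a b => (continuous_gsin k).intervalIntegrable a b) 0
  have hr : Continuous fun p : Plane k => radius O p := by unfold radius; fun_prop
  exact h.comp hr

/-- The factor `ℓ ^ 2` cancels the denominator of `dθ`. At `O` and its antipode both frame
components of `p - O` vanish, so the default value `0` is the value of the smooth extension. -/
theorem Frame.ell_sq_mul_dTheta (F : Frame O) (p : Plane k) (v : Ambient) :
    F.ell (radius O p) ^ 2 * F.dTheta p v = areaForm O (p.val - O.val) v := by
  rw [F.ell_eq, sq_abs, F.gsin_radius_sq, F.areaForm_eq_sub, Frame.dTheta]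
  rcases eq_or_ne (form k (p.val - O.val) F.e₁ ^ 2 + form k (p.val - O.val) F.e₂ ^ 2) 0 with h | h
  · have h1 : form k (p.val - O.val) F.e₁ = 0 := by
      nlinarith [sq_nonneg (form k (p.val - O.val) F.e₁), sq_nonneg (form k (p.val - O.val) F.e₂)]
    have h2 : form k (p.val - O.val) F.e₂ = 0 := by
      nlinarith [sq_nonneg (form k (p.val - O.val) F.e₁), sq_nonneg (form k (p.val - O.val) F.e₂)]
    rw [h1, h2]; simp
  · rw [mul_div_cancel₀ _ h]

/-! ### Curves -/

/-- The algebraic core: the derivative of the inner product of the closed conformal vector field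
`gsin ρ ∂_ρ` with the unit tangent of a curve. -/
theorem closed_conformal_identity (O p : Plane k) {v a : Ambient} (hv : IsTangent p v)
    (ha : form k (unitNormal p) a = -√|k| * form k v v) :
    (form k v v + form k (p.val - O.val) a) * form k v v
        - form k (p.val - O.val) v * form k v a
      = gcos k (radius O p) * form k v v ^ 2
        - areaForm O (p.val - O.val) v * areaForm p v a := by
  rw [areaForm_eq, areaForm_eq]
  by_cases hk : k = 0
  · subst hk
    have hv0 : v 0 = 0 := by simpa [IsTangent] using hv
    have ha0 : a 0 = 0 := by simpa [unitNormal, form_def, formSign] using ha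
    have hg : ∀ r, gcos 0 r = 1 := by intro r; simp [gcos]
    simp only [hg, det₃, unitNormal, form_def, formSign, if_true, lt_irrefl, if_false, hv0, ha0,
      Pi.sub_apply, val_zero_eq, Matrix.cons_val_zero, Matrix.cons_val_one, Matrix.cons_val]
    ring
  · have hv' := hv.form_eq_zero hk
    rw [unitNormal_of_ne hk, form_smul_left] at ha
    have hsk : √|k| ≠ 0 := (Real.sqrt_pos.2 (abs_pos.2 hk)).ne'
    have ha' : form k p.val a = -form k v v := by
      apply mul_left_cancel₀ hsk; linarith
    rw [radius, gcos_dist hk, unitNormal_of_ne hk, unitNormal_of_ne hk]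
    have e : det₃ (√|k| • O.val) (p.val - O.val) v * det₃ (√|k| • p.val) v a
        = |k| * (det₃ O.val p.val v * det₃ p.val v a) := by
      have e1 : det₃ (√|k| • O.val) (p.val - O.val) v = √|k| * det₃ O.val p.val v := by
        simp only [det₃, Pi.sub_apply, Pi.smul_apply, smul_eq_mul]; ring
      have e2 : det₃ (√|k| • p.val) v a = √|k| * det₃ p.val v a := by
        simp only [det₃, Pi.smul_apply, smul_eq_mul]; ring
      rw [e1, e2]
      linear_combination (det₃ O.val p.val v * det₃ p.val v a) * Real.mul_self_sqrt (abs_nonneg k)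
    -- The Gram identity rewrites the product of the two area forms through inner products, all
    -- known from tangency of `v` and the normal component of `a`.
    have g := det₃_mul_det₃ (k := k) O.val p.val v p.val v a
    rw [form_self_eq hk, hv', ha', form_comm k v p.val, hv'] at g
    have hs := formSign_mul_self k
    have hsa := formSign_mul_abs k
    have e2 : |k| * (det₃ O.val p.val v * det₃ p.val v a)
        = k * (formSign k * (det₃ O.val p.val v * det₃ p.val v a)) := by
      linear_combination (-(formSign k) * (det₃ O.val p.val v * det₃ p.val v a)) * hsa.symm
         - (|k| * (det₃ O.val p.val v * det₃ p.val v a)) * hs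
    rw [e, e2, g, form_sub_left, form_sub_left, ha', hv']
    field_simp
    ring

/-- Differentiate the equation of the surface along the curve. -/
theorem isTangent_of_hasDerivAt {γ : ℝ → Plane k} {t : ℝ} {v : Ambient}
    (h : HasDerivAt (fun s => (γ s).val) v t) : IsTangent (γ t) v := by
  by_cases hk : k = 0
  · subst hk
    rw [IsTangent, if_pos rfl]
    have h0 := hasDerivAt_pi.1 h 0
    have : (fun s => (γ s).val 0) = fun _ => (0 : ℝ) := funext fun s => val_zero_eq _
    rw [this] at h0
    exact h0.unique (hasDerivAt_const t 0)
  · rw [IsTangent, if_neg hk]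
    have h1 := hasDerivAt_form (k := k) h h
    have : (fun s => form k (γ s).val (γ s).val) = fun _ => 1 / k :=
      funext fun s => form_self_eq hk _
    rw [this] at h1
    have := h1.unique (hasDerivAt_const t _)
    rw [form_comm k v] at this
    linarith

theorem hasDerivAt_velocity_of {γ : ℝ → Plane k} {t : ℝ}
    (h : ContDiffAt ℝ 2 (fun s => (γ s).val) t) :
    HasDerivAt (fun s => (γ s).val) (velocity γ t) t :=
  (h.differentiableAt two_ne_zero).hasDerivAt

theorem contDiffAt_velocity {γ : ℝ → Plane k} {t : ℝ}
    (h : ContDiffAt ℝ 2 (fun s => (γ s).val) t) : ContDiffAt ℝ 1 (velocity γ) t := by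
  have h1 := h.fderiv_right (m := 1) (by norm_num)
  exact (h1.clm_apply contDiffAt_const : ContDiffAt ℝ 1
    (fun s => fderiv ℝ (fun s => (γ s).val) s 1) t)

theorem hasDerivAt_acceleration {γ : ℝ → Plane k} {t : ℝ}
    (h : ContDiffAt ℝ 2 (fun s => (γ s).val) t) :
    HasDerivAt (velocity γ) (acceleration γ t) t :=
  ((contDiffAt_velocity h).differentiableAt one_ne_zero).hasDerivAt

theorem continuousAt_acceleration {γ : ℝ → Plane k} {t : ℝ}
    (h : ContDiffAt ℝ 2 (fun s => (γ s).val) t) : ContinuousAt (acceleration γ) t := by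
  have h1 := (contDiffAt_velocity h).fderiv_right (m := 0) (by norm_num)
  exact ((h1.clm_apply contDiffAt_const : ContDiffAt ℝ 0
    (fun s => fderiv ℝ (velocity γ) s 1) t)).continuousAt

theorem isTangent_velocity {γ : ℝ → Plane k} {t : ℝ}
    (h : ContDiffAt ℝ 2 (fun s => (γ s).val) t) : IsTangent (γ t) (velocity γ t) :=
  isTangent_of_hasDerivAt (hasDerivAt_velocity_of h)

theorem eventually_contDiffAt {γ : ℝ → Plane k} {t : ℝ}
    (h : ContDiffAt ℝ 2 (fun s => (γ s).val) t) :
    ∀ᶠ s in 𝓝 t, ContDiffAt ℝ 2 (fun s => (γ s).val) s :=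
  h.eventually (by simp)

/-- Differentiating `⟨γ, γ'⟩ = 0` gives `⟨γ, γ''⟩ = -⟨γ', γ'⟩`; in the flat case the normal
coordinate of the velocity is constantly zero. -/
theorem form_unitNormal_acceleration {γ : ℝ → Plane k} {t : ℝ}
    (h : ContDiffAt ℝ 2 (fun s => (γ s).val) t) :
    form k (unitNormal (γ t)) (acceleration γ t)
      = -√|k| * form k (velocity γ t) (velocity γ t) := by
  have hT : ∀ᶠ s in 𝓝 t, IsTangent (γ s) (velocity γ s) :=
    (eventually_contDiffAt h).mono fun s hs => isTangent_velocity hs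
  have ha := hasDerivAt_acceleration h
  by_cases hk : k = 0
  · subst hk
    have h0 := hasDerivAt_pi.1 ha 0
    have h1 : (fun s => velocity γ s 0) =ᶠ[𝓝 t] fun _ => 0 := by
      filter_upwards [hT] with s hs
      simpa [IsTangent] using hs
    have := (h0.congr_of_eventuallyEq h1.symm).unique (hasDerivAt_const t 0)
    simp [unitNormal, form_def, this]
  · have h1 := hasDerivAt_form (k := k) (hasDerivAt_velocity_of h) ha
    have h2 : (fun s => form k (γ s).val (velocity γ s)) =ᶠ[𝓝 t] fun _ => 0 := by
      filter_upwards [hT] with s hs using hs.form_eq_zero hk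
    have := (h1.congr_of_eventuallyEq h2.symm).unique (hasDerivAt_const t 0)
    rw [unitNormal_of_ne hk, form_smul_left]
    linear_combination √|k| * this

/-- Along a regular `C²` curve, the inner product of the closed conformal field `gsin ρ ∂_ρ` with
the unit tangent has derivative `gcos ρ - ℓ(ρ)² κ_g dθ(T)` with respect to arc length. -/
theorem Frame.hasDerivAt_form_div_length (F : Frame O) {γ : ℝ → Plane k} {t : ℝ}
    (h : ContDiffAt ℝ 2 (fun s => (γ s).val) t) (hv : velocity γ t ≠ 0) :
    HasDerivAt (fun s => form k ((γ s).val - O.val) (velocity γ s) / length k (velocity γ s))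
      (gcos k (radius O (γ t)) * length k (velocity γ t) - F.ell (radius O (γ t)) ^ 2 *
        geodesicCurvature γ t * F.dTheta (γ t) (velocity γ t)) t := by
  have hpos := (isTangent_velocity h).form_pos hv
  have h1 := hasDerivAt_form (k := k) ((hasDerivAt_velocity_of h).sub_const O.val)
    (hasDerivAt_acceleration h)
  have h2 := hasDerivAt_form (k := k) (hasDerivAt_acceleration h) (hasDerivAt_acceleration h)
  have h3 := h1.div (h2.sqrt hpos.ne') (Real.sqrt_pos.2 hpos).ne'
  refine h3.congr_deriv ?_
  have hid := closed_conformal_identity O (γ t) (isTangent_velocity h)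
    (form_unitNormal_acceleration h)
  have hL : 0 < length k (velocity γ t) := Real.sqrt_pos.2 hpos
  have hLs : form k (velocity γ t) (velocity γ t) = length k (velocity γ t) ^ 2 :=
    (Real.sq_sqrt hpos.le).symm
  rw [mul_right_comm, F.ell_sq_mul_dTheta, geodesicCurvature,
    form_comm k (acceleration γ t) (velocity γ t)]
  have hs : √(form k (velocity γ t) (velocity γ t)) = length k (velocity γ t) := rfl
  rw [hs]
  rw [hLs] at hid ⊢
  have : (areaForm O ((γ t).val - O.val) (velocity γ t)) *
      areaForm (γ t) (velocity γ t) (acceleration γ t) =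
      gcos k (radius O (γ t)) * (length k (velocity γ t) ^ 2) ^ 2 -
      ((length k (velocity γ t) ^ 2 + form k ((γ t).val - O.val) (acceleration γ t)) *
        length k (velocity γ t) ^ 2 - form k ((γ t).val - O.val) (velocity γ t) *
        form k (velocity γ t) (acceleration γ t)) := by linarith
  rw [← mul_div_assoc (areaForm O _ _), this]
  field_simp
  ring

end PlaneGeometry

namespace PlaneGeometry

variable {k : ℝ} {O p : Plane k}

/-! ### The topology of the plane -/

/-- In polar coordinates about `p` the point `q` is `gcos • p` plus `gsin` times a unit tangent
vector; this isolates the second term without constructing the direction. -/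
theorem form_sub_gcos_smul (p q : Plane k) :
    IsTangent p (q.val - gcos k (dist p q) • p.val) ∧
      form k (q.val - gcos k (dist p q) • p.val) (q.val - gcos k (dist p q) • p.val)
        = gsin k (dist p q) ^ 2 := by
  by_cases hk : k = 0
  · subst hk
    have h1 : gcos 0 (dist p q) = 1 := by simp [gcos]
    have h2 : gsin 0 (dist p q) = dist p q := by simp [gsin]
    rw [h1, h2, one_smul, dist_comm, dist_sq_zero]
    exact ⟨by simp [IsTangent, val_zero_eq], rfl⟩
  · have h1 := gcos_sq_add k (dist p q)
    have h2 := gcos_dist hk p q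
    have h3 := mul_form_self hk p
    have h4 := mul_form_self hk q
    constructor
    · rw [IsTangent, if_neg hk, form_sub_right, form_smul_right, h2]
      linear_combination -form k p.val q.val * h3
    · apply mul_left_cancel₀ hk
      simp only [form_sub_left, form_sub_right, form_smul_left, form_smul_right,
        form_comm k q.val p.val]
      linear_combination h4 - h1 + gcos k (dist p q) ^ 2 * h3 + 2 * gcos k (dist p q) * h2

/-- The tangential part of `q` at `p` has squared length `gsin (dist p q) ^ 2`, and
`IsTangent.sq_le` converts this into a bound on its ambient coordinates, even when the ambient form
is indefinite. -/
theorem continuous_val (k : ℝ) : Continuous (Plane.val : Plane k → Ambient) := by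
  refine continuous_iff_continuousAt.2 fun p => ?_
  have hd : Tendsto (fun q => dist p q) (𝓝 p) (𝓝 0) := by
    have : Continuous fun q : Plane k => dist p q := by fun_prop
    simpa using this.tendsto p
  have hc : Tendsto (fun q => gcos k (dist p q)) (𝓝 p) (𝓝 1) := by
    have := (continuous_gcos k).tendsto 0
    rw [gcos_zero] at this
    exact this.comp hd
  have hs : Tendsto (fun q => (2 * unitNormal p 0 ^ 2 + 1) * gsin k (dist p q) ^ 2)
      (𝓝 p) (𝓝 0) := by
    have := (continuous_gsin k).tendsto 0
    rw [gsin_zero] at this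
    simpa using ((this.comp hd).pow 2).const_mul (2 * unitNormal p 0 ^ 2 + 1)
  have hw : Tendsto (fun q : Plane k => q.val - gcos k (dist p q) • p.val) (𝓝 p) (𝓝 0) := by
    rw [tendsto_pi_nhds]
    intro i
    have hsq : Tendsto (fun q : Plane k => (q.val - gcos k (dist p q) • p.val) i ^ 2)
        (𝓝 p) (𝓝 0) := by
      refine squeeze_zero (fun q => sq_nonneg _) (fun q => ?_) hs
      have h := (form_sub_gcos_smul p q).1.sq_le
      rw [(form_sub_gcos_smul p q).2] at h
      refine le_trans ?_ h
      have a0 := sq_nonneg ((q.val - gcos k (dist p q) • p.val) 0)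
      have a1 := sq_nonneg ((q.val - gcos k (dist p q) • p.val) 1)
      have a2 := sq_nonneg ((q.val - gcos k (dist p q) • p.val) 2)
      fin_cases i <;> simp only [Fin.zero_eta, Fin.mk_one, Fin.reduceFinMk] <;> linarith
    have := hsq.sqrt
    simp only [Real.sqrt_sq_eq_abs, Real.sqrt_zero] at this
    exact (tendsto_zero_iff_abs_tendsto_zero _).2 this
  have := hw.add (hc.smul_const p.val)
  simpa [ContinuousAt] using this

/-- The geodesic distance depends continuously on ambient positions, so its topology is the subspace
topology. Continuity and differentiability questions can then be moved to `ℝ³`. -/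
theorem isInducing_val (k : ℝ) : IsInducing (Plane.val : Plane k → Ambient) := by
  refine isInducing_iff_nhds.2 fun p =>
    le_antisymm (continuous_val k).continuousAt.tendsto.le_comap ?_
  rw [← tendsto_id', tendsto_iff_dist_tendsto_zero]
  have hval : Tendsto (Plane.val : Plane k → Ambient) (comap Plane.val (𝓝 p.val)) (𝓝 p.val) :=
    tendsto_comap
  have hf : Tendsto (fun q : Plane k => k * form k q.val p.val) (comap Plane.val (𝓝 p.val))
      (𝓝 (k * form k p.val p.val)) := by
    have : Continuous fun x : Ambient => k * form k x p.val := by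
      unfold form; fun_prop
    exact (this.tendsto p.val).comp hval
  simp only [id, dist_eq, geodesicDist]
  split_ifs with h1 h2
  · rw [mul_form_self h1.ne'] at hf
    simpa using ((Real.continuous_arccos.tendsto 1).comp hf).div_const √k
  · rw [mul_form_self h2.ne] at hf
    -- Continuity of `arcosh` is used only on `[1, ∞)`, so the limit has to be taken within that
    -- half-line.
    have hf' : Tendsto (fun q : Plane k => k * form k q.val p.val)
        (comap Plane.val (𝓝 p.val)) (𝓝[Ici 1] 1) :=
      tendsto_nhdsWithin_iff.2 ⟨hf, Eventually.of_forall fun q => one_le_mul_form h2 q p⟩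
    simpa using ((Real.continuousOn_arcosh 1 self_mem_Ici).tendsto.comp hf').div_const √(-k)
  · have : Continuous fun x : Ambient => √(form k (x - p.val) (x - p.val)) := by
      unfold form; fun_prop
    have := (this.tendsto p.val).comp hval
    simpa [form_def, Function.comp_def] using this

instance (k : ℝ) : SecondCountableTopology (Plane k) :=
  (isInducing_val k).secondCountableTopology

/-! ### Chords and metric speed -/

theorem gcos_two_mul (k r : ℝ) : gcos k (2 * r) = 1 - 2 * (k * gsin k r ^ 2) := by
  unfold gcos gsin
  split_ifs with h1 h2
  · rw [div_pow, Real.sq_sqrt h1.le, mul_div_cancel₀ _ h1.ne', mul_left_comm, Real.cos_two_mul]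
    linarith [Real.sin_sq_add_cos_sq (√k * r)]
  · rw [div_pow, Real.sq_sqrt (by linarith), mul_left_comm, Real.cosh_two_mul]
    have : k * (Real.sinh (√(-k) * r) ^ 2 / -k) = -Real.sinh (√(-k) * r) ^ 2 := by
      have := h2.ne
      field_simp
    rw [this]
    linarith [Real.cosh_sq (√(-k) * r)]
  · rw [le_antisymm (not_lt.1 h1) (not_lt.1 h2)]; ring

/-- The chord in the ambient space, in terms of the distance. -/
theorem form_sub_eq_gsin (p q : Plane k) :
    form k (p.val - q.val) (p.val - q.val) = (2 * gsin k (dist p q / 2)) ^ 2 := by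
  by_cases hk : k = 0
  · subst hk
    have : ∀ r, gsin 0 r = r := by intro r; simp [gsin]
    rw [← dist_sq_zero, this]; ring
  · apply mul_left_cancel₀ hk
    have := gcos_two_mul k (dist p q / 2)
    rw [mul_div_cancel₀ _ two_ne_zero, gcos_dist hk] at this
    rw [form_sub_self hk, this]; ring

theorem length_smul (c : ℝ) (v : Ambient) : length k (c • v) = |c| * length k v := by
  rw [length, length, form_smul_left, form_smul_right, ← mul_assoc, ← sq,
    Real.sqrt_mul (sq_nonneg c), Real.sqrt_sq_eq_abs]

theorem continuous_length (k : ℝ) : Continuous (length k) := by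
  unfold length form; fun_prop

/-- Infinitesimally, the distance along a curve is the length of the velocity. -/
theorem tendsto_dist_div {γ : ℝ → Plane k} {t : ℝ} {v : Ambient}
    (h : HasStrictDerivAt (fun s => (γ s).val) v t) :
    Tendsto (fun x : ℝ × ℝ => dist (γ x.1) (γ x.2) / |x.1 - x.2|)
      (𝓝 (t, t) ⊓ 𝓟 {x | x.1 ≠ x.2}) (𝓝 (length k v)) := by
  set l := 𝓝 (t, t) ⊓ 𝓟 {x : ℝ × ℝ | x.1 ≠ x.2}
  have hne : ∀ᶠ x in l, x.1 - x.2 ≠ 0 :=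
    (eventually_inf_principal.2 (Eventually.of_forall fun x hx => sub_ne_zero.2 hx))
  have hγ : ContinuousAt γ t := (isInducing_val k).continuousAt_iff.2 h.hasDerivAt.continuousAt
  have hd : Tendsto (fun x : ℝ × ℝ => dist (γ x.1) (γ x.2)) l (𝓝 0) := by
    have h1 : Tendsto (fun x : ℝ × ℝ => γ x.1) (𝓝 (t, t)) (𝓝 (γ t)) :=
      hγ.tendsto.comp (continuous_fst.tendsto (t, t))
    have h2 : Tendsto (fun x : ℝ × ℝ => γ x.2) (𝓝 (t, t)) (𝓝 (γ t)) :=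
      hγ.tendsto.comp (continuous_snd.tendsto (t, t))
    have := h1.dist h2
    rw [dist_self] at this
    exact this.mono_left inf_le_left
  -- Strict differentiability is what allows both endpoints of the chord to move.
  have hchord : Tendsto (fun x : ℝ × ℝ => length k ((γ x.1).val - (γ x.2).val) / |x.1 - x.2|) l
      (𝓝 (length k v)) := by
    have h1 := (HasStrictFDerivAt.isLittleO h.hasStrictFDerivAt).tendsto_inv_smul_nhds_zero
    have h2 := (h1.mono_left (inf_le_left : l ≤ _)).add_const v
    rw [zero_add] at h2
    refine (((continuous_length k).tendsto v).comp h2).congr' ?_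
    filter_upwards [hne] with x hx
    have : (x.1 - x.2)⁻¹ • ((γ x.1).val - (γ x.2).val -
        (ContinuousLinearMap.toSpanSingleton ℝ v) (x.1 - x.2)) + v
        = (x.1 - x.2)⁻¹ • ((γ x.1).val - (γ x.2).val) := by
      rw [ContinuousLinearMap.toSpanSingleton_apply, smul_sub, smul_smul, inv_mul_cancel₀ hx]
      simp
    simp only [Function.comp_apply]
    rw [this, length_smul, abs_inv, div_eq_inv_mul]
  -- The chord length is `|φ d|` for `φ d = 2 * gsin k (d / 2)`, and `φ' 0 = 1`: chord and distance
  -- agree to first order. The slope `dslope` also covers `d = 0`.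
  have hφ : HasDerivAt (fun d => 2 * gsin k (d / 2)) 1 0 := by
    have h1 := hasDerivAt_gsin k (0 / 2)
    have h2 := (h1.comp 0 ((hasDerivAt_id (0 : ℝ)).div_const 2)).const_mul 2
    refine h2.congr_deriv ?_
    simp [gcos_zero]
  set φ := fun d => 2 * gsin k (d / 2) with hφdef
  have hψ : Tendsto (fun x : ℝ × ℝ => |dslope φ 0 (dist (γ x.1) (γ x.2))|) l (𝓝 1) := by
    have := continuousAt_dslope_same.2 hφ.differentiableAt
    have h2 := (this.tendsto.comp hd).abs
    rwa [dslope_same, hφ.deriv, abs_one] at h2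
  have hlen : ∀ x : ℝ × ℝ, length k ((γ x.1).val - (γ x.2).val)
      = dist (γ x.1) (γ x.2) * |dslope φ 0 (dist (γ x.1) (γ x.2))| := by
    intro x
    have h1 := sub_smul_dslope φ 0 (dist (γ x.1) (γ x.2))
    have h0 : φ 0 = 0 := by simp [hφdef, gsin_zero]
    rw [h0, sub_zero, sub_zero, smul_eq_mul] at h1
    rw [length, form_sub_eq_gsin, Real.sqrt_sq_eq_abs]
    change |φ _| = _
    rw [← h1, abs_mul, abs_of_nonneg dist_nonneg]
  have := hchord.div hψ one_ne_zero
  rw [div_one] at this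
  refine this.congr' ?_
  filter_upwards [hψ.eventually_ne one_ne_zero] with x hx
  simp only [Pi.div_apply, hlen]
  field_simp

end PlaneGeometry

open scoped ENNReal NNReal

namespace PlaneGeometry

/-! ### One-dimensional Hausdorff measure of curves -/

/-- Both quantities lie between `c₁ * volume A` and `c₂ * volume A`: the integral by the bounds on
`L`, the Hausdorff measure because `g` is `c₂`-Lipschitz on `A` with a `c₁⁻¹`-Lipschitz inverse. -/
theorem hausdorffMeasure_image_le_mul_lintegral {X : Type*} [MetricSpace X] [MeasurableSpace X]
    [BorelSpace X] {g : ℝ → X} {L : ℝ → ℝ} {A : Set ℝ} (hA : MeasurableSet A) {c₁ c₂ : ℝ}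
    (h₁ : 0 < c₁) (h₂ : 0 < c₂) (hlow : ∀ s ∈ A, ∀ t ∈ A, c₁ * |s - t| ≤ dist (g s) (g t))
    (hup : ∀ s ∈ A, ∀ t ∈ A, dist (g s) (g t) ≤ c₂ * |s - t|)
    (hL : ∀ t ∈ A, c₁ ≤ L t ∧ L t ≤ c₂) :
    Measure.hausdorffMeasure 1 (g '' A)
        ≤ ENNReal.ofReal (c₂ / c₁) * ∫⁻ t in A, ENNReal.ofReal (L t) ∧
      ∫⁻ t in A, ENNReal.ofReal (L t)
        ≤ ENNReal.ofReal (c₂ / c₁) * Measure.hausdorffMeasure 1 (g '' A) := by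
  have hr : ENNReal.ofReal (c₂ / c₁) * ENNReal.ofReal c₁ = ENNReal.ofReal c₂ := by
    rw [← ENNReal.ofReal_mul (by positivity), div_mul_cancel₀ _ h₁.ne']
  have i1 : ENNReal.ofReal c₁ * volume A ≤ ∫⁻ t in A, ENNReal.ofReal (L t) := by
    rw [← setLIntegral_const]
    exact setLIntegral_mono' hA fun t ht => ENNReal.ofReal_le_ofReal (hL t ht).1
  have i2 : ∫⁻ t in A, ENNReal.ofReal (L t) ≤ ENNReal.ofReal c₂ * volume A := by
    rw [← setLIntegral_const]
    exact setLIntegral_mono' hA fun t ht => ENNReal.ofReal_le_ofReal (hL t ht).2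
  have m1 : Measure.hausdorffMeasure 1 (g '' A) ≤ ENNReal.ofReal c₂ * volume A := by
    have hlip : LipschitzOnWith (Real.toNNReal c₂) g A :=
      LipschitzOnWith.of_dist_le_mul fun s hs t ht => by
        rw [Real.coe_toNNReal _ h₂.le, Real.dist_eq]; exact hup s hs t ht
    have := hlip.hausdorffMeasure_image_le (d := 1) zero_le_one
    rwa [ENNReal.rpow_one, hausdorffMeasure_real] at this
  have m2 : ENNReal.ofReal c₁ * volume A ≤ Measure.hausdorffMeasure 1 (g '' A) := by
    have hinj : InjOn g A := fun s hs t ht hst => by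
      have := hlow s hs t ht
      rw [hst, dist_self] at this
      have := nonpos_of_mul_nonpos_right this h₁
      exact sub_eq_zero.1 (abs_eq_zero.1 (le_antisymm this (abs_nonneg _)))
    have hinv : ∀ t ∈ A, Function.invFunOn g A (g t) = t := fun t ht =>
      hinj.leftInvOn_invFunOn ht
    have hlip : LipschitzOnWith (Real.toNNReal c₁⁻¹) (Function.invFunOn g A) (g '' A) := by
      refine LipschitzOnWith.of_dist_le_mul ?_
      rintro _ ⟨s, hs, rfl⟩ _ ⟨t, ht, rfl⟩
      rw [hinv s hs, hinv t ht, Real.coe_toNNReal _ (inv_pos.2 h₁).le, Real.dist_eq,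
        le_inv_mul_iff₀ h₁]
      exact hlow s hs t ht
    have := hlip.hausdorffMeasure_image_le (d := 1) zero_le_one
    have himg : Function.invFunOn g A '' (g '' A) = A := by
      rw [image_image]
      exact (image_congr hinv).trans (image_id' A)
    rw [ENNReal.rpow_one, hausdorffMeasure_real, himg] at this
    calc ENNReal.ofReal c₁ * volume A
        ≤ ENNReal.ofReal c₁ * (ENNReal.ofReal c₁⁻¹ * Measure.hausdorffMeasure 1 (g '' A)) := by
          gcongr; exact this
      _ = _ := by
          rw [← mul_assoc, ← ENNReal.ofReal_mul h₁.le, mul_inv_cancel₀ h₁.ne', ENNReal.ofReal_one,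
            one_mul]
  constructor
  · calc _ ≤ ENNReal.ofReal c₂ * volume A := m1
      _ = ENNReal.ofReal (c₂ / c₁) * (ENNReal.ofReal c₁ * volume A) := by rw [← mul_assoc, hr]
      _ ≤ _ := by gcongr
  · calc _ ≤ ENNReal.ofReal c₂ * volume A := i2
      _ = ENNReal.ofReal (c₂ / c₁) * (ENNReal.ofReal c₁ * volume A) := by rw [← mul_assoc, hr]
      _ ≤ _ := by gcongr

/-- The Hausdorff measure of an injective curve is the integral of its metric speed. -/
theorem hausdorffMeasure_image_eq_lintegral {X : Type*} [MetricSpace X] [MeasurableSpace X]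
    [BorelSpace X] {g : ℝ → X} {L : ℝ → ℝ} {s : Set ℝ} (hg : ContinuousOn g s)
    (hinj : InjOn g s) (hLc : ContinuousOn L s) (hLpos : ∀ t ∈ s, 0 < L t)
    (hd : ∀ t ∈ s, Tendsto (fun x : ℝ × ℝ => dist (g x.1) (g x.2) / |x.1 - x.2|)
      (𝓝 (t, t) ⊓ 𝓟 {x | x.1 ≠ x.2}) (𝓝 (L t)))
    {A : Set ℝ} (hAs : A ⊆ s) (hA : MeasurableSet A) :
    Measure.hausdorffMeasure 1 (g '' A) = ∫⁻ t in A, ENNReal.ofReal (L t) := by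
  -- Near each parameter the metric speed is almost constant, so the bi-Lipschitz comparison costs
  -- only a factor `η`. Countably many disjoint pieces are summed, then `η → 1`.
  have key : ∀ η : ℝ, 1 < η → Measure.hausdorffMeasure 1 (g '' A)
        ≤ ENNReal.ofReal η * ∫⁻ t in A, ENNReal.ofReal (L t) ∧
      ∫⁻ t in A, ENNReal.ofReal (L t)
        ≤ ENNReal.ofReal η * Measure.hausdorffMeasure 1 (g '' A) := by
    intro η hη
    have hr : 1 < √η := by rw [Real.lt_sqrt zero_le_one]; simpa using hη
    have hr0 : 0 < √η := by positivity
    have loc : ∀ t ∈ A, ∃ U, IsOpen U ∧ t ∈ U ∧ ∀ B ⊆ U ∩ A, MeasurableSet B →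
        Measure.hausdorffMeasure 1 (g '' B)
          ≤ ENNReal.ofReal η * ∫⁻ t in B, ENNReal.ofReal (L t) ∧
        ∫⁻ t in B, ENNReal.ofReal (L t)
          ≤ ENNReal.ofReal η * Measure.hausdorffMeasure 1 (g '' B) := by
      intro t ht
      have hL0 := hLpos t (hAs ht)
      have b1 : L t / √η < L t := div_lt_self hL0 hr
      have b2 : L t < L t * √η := lt_mul_of_one_lt_right hL0 hr
      have e1 := (hd t (hAs ht)).eventually (Icc_mem_nhds b1 b2)
      rw [eventually_inf_principal, nhds_prod_eq] at e1
      obtain ⟨u, hu, hu'⟩ := mem_prod_self_iff.1 e1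
      have e2 := (hLc t (hAs ht)).eventually (Icc_mem_nhds b1 b2)
      rw [eventually_iff, mem_nhdsWithin] at e2
      obtain ⟨w, hwo, htw, hw⟩ := e2
      obtain ⟨u₀, hu₀, huo, htu⟩ := mem_nhds_iff.1 hu
      refine ⟨u₀ ∩ w, huo.inter hwo, ⟨htu, htw⟩, fun B hB hBm => ?_⟩
      have hc : L t * √η / (L t / √η) = η := by
        rw [div_div_eq_mul_div, mul_assoc, Real.mul_self_sqrt (by linarith)]
        field_simp
      -- The constants `L t / √η` and `L t * √η` have ratio exactly `η`.
      have := hausdorffMeasure_image_le_mul_lintegral (g := g) (L := L) hBm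
        (c₁ := L t / √η) (c₂ := L t * √η) (by positivity) (by positivity) ?_ ?_ ?_
      · rwa [hc] at this
      · intro x hx y hy
        rcases eq_or_ne x y with rfl | hxy
        · simp
        · exact (le_div_iff₀ (abs_pos.2 (sub_ne_zero.2 hxy))).1
            (hu' (Set.mk_mem_prod (hu₀ (hB hx).1.1) (hu₀ (hB hy).1.1)) hxy).1
      · intro x hx y hy
        rcases eq_or_ne x y with rfl | hxy
        · simp
        · exact (div_le_iff₀ (abs_pos.2 (sub_ne_zero.2 hxy))).1
            (hu' (Set.mk_mem_prod (hu₀ (hB hx).1.1) (hu₀ (hB hy).1.1)) hxy).2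
      · intro x hx
        exact hw ⟨(hB hx).1.2, hAs (hB hx).2⟩
    choose! U hUo hUt hU using loc
    obtain ⟨T, hTA, hTc, hTU⟩ := TopologicalSpace.countable_cover_nhdsWithin
      (f := U) (s := A) fun t ht => mem_nhdsWithin_of_mem_nhds ((hUo t ht).mem_nhds (hUt t ht))
    rcases T.eq_empty_or_nonempty with rfl | hTne
    · have : A = ∅ := by simpa using hTU
      subst this; simp
    obtain ⟨e, he⟩ := hTc.exists_eq_range hTne
    have heA : ∀ n, e n ∈ A := fun n => hTA (he ▸ mem_range_self n)
    set B : ℕ → Set ℝ := fun n => A ∩ disjointed (fun n => U (e n)) n with hB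
    have hBm : ∀ n, MeasurableSet (B n) := fun n =>
      hA.inter (MeasurableSet.disjointed (fun n => (hUo _ (heA n)).measurableSet) n)
    have hBd : Pairwise (Function.onFun Disjoint B) := fun i j hij =>
      ((disjoint_disjointed fun n => U (e n)) hij).mono inter_subset_right inter_subset_right
    have hBU : A = ⋃ n, B n := by
      rw [hB, ← inter_iUnion, iUnion_disjointed, eq_comm, inter_eq_left]
      intro x hx
      obtain ⟨y, hy, hxy⟩ := mem_iUnion₂.1 (hTU hx)
      rw [he] at hy
      obtain ⟨n, rfl⟩ := hy
      exact mem_iUnion.2 ⟨n, hxy⟩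
    have hBs : ∀ n, B n ⊆ s := fun n => inter_subset_left.trans hAs
    have hBsub : ∀ n, B n ⊆ U (e n) ∩ A := fun n x hx =>
      ⟨disjointed_subset (fun n => U (e n)) n hx.2, hx.1⟩
    have sum1 : Measure.hausdorffMeasure 1 (g '' A)
        = ∑' n, Measure.hausdorffMeasure 1 (g '' B n) := by
      conv_lhs => rw [hBU, image_iUnion]
      -- Injectivity of `g` is used twice: it keeps the images disjoint, and it makes images of
      -- Borel sets measurable (Lusin–Souslin).
      refine measure_iUnion (fun i j hij => ?_) fun n =>
        (hBm n).image_of_continuousOn_injOn (hg.mono (hBs n)) (hinj.mono (hBs n))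
      exact (hBd hij).image hinj (hBs i) (hBs j)
    have sum2 : ∫⁻ t in A, ENNReal.ofReal (L t) = ∑' n, ∫⁻ t in B n, ENNReal.ofReal (L t) := by
      conv_lhs => rw [hBU]
      exact lintegral_iUnion hBm hBd _
    rw [sum1, sum2, ← ENNReal.tsum_mul_left, ← ENNReal.tsum_mul_left]
    exact ⟨ENNReal.tsum_le_tsum fun n => (hU _ (heA n) _ (hBsub n) (hBm n)).1,
      ENNReal.tsum_le_tsum fun n => (hU _ (heA n) _ (hBsub n) (hBm n)).2⟩
  have lim : ∀ a b : ℝ≥0∞, (∀ η : ℝ, 1 < η → a ≤ ENNReal.ofReal η * b) → a ≤ b := by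
    intro a b h
    have ht : Tendsto (fun η : ℝ => ENNReal.ofReal η * b) (𝓝[>] 1) (𝓝 (ENNReal.ofReal 1 * b)) :=
      ENNReal.Tendsto.mul_const
        ((ENNReal.continuous_ofReal.tendsto 1).mono_left nhdsWithin_le_nhds) (by simp)
    rw [ENNReal.ofReal_one, one_mul] at ht
    exact ge_of_tendsto ht (eventually_nhdsWithin_of_forall fun η hη => h η hη)
  exact le_antisymm (lim _ _ fun η hη => (key η hη).1) (lim _ _ fun η hη => (key η hη).2)

/-- Hausdorff measure on an injective curve as an image measure. -/
theorem restrict_hausdorffMeasure_image {X : Type*} [MetricSpace X] [MeasurableSpace X]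
    [BorelSpace X] {g : ℝ → X} {L : ℝ → ℝ} {s : Set ℝ} (hs : MeasurableSet s)
    (hg : ContinuousOn g s) (hinj : InjOn g s) (hLc : ContinuousOn L s) (hLpos : ∀ t ∈ s, 0 < L t)
    (hd : ∀ t ∈ s, Tendsto (fun x : ℝ × ℝ => dist (g x.1) (g x.2) / |x.1 - x.2|)
      (𝓝 (t, t) ⊓ 𝓟 {x | x.1 ≠ x.2}) (𝓝 (L t))) :
    (Measure.hausdorffMeasure 1 : Measure X).restrict (g '' s)
      = ((volume.restrict s).withDensity fun t => ENNReal.ofReal (L t)).map g := by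
  have hgm : AEMeasurable g (volume.restrict s) := hg.aemeasurable hs
  have hgm' : AEMeasurable g ((volume.restrict s).withDensity fun t => ENNReal.ofReal (L t)) :=
    hgm.mono_ac (withDensity_absolutelyContinuous _ _)
  ext B hB
  -- Off `s` nothing is known about `g`, so measurability is obtained on the subtype.
  have hm : MeasurableSet (s ∩ g ⁻¹' B) := by
    have := hs.subtype_image (hg.domRestrict.measurable hB)
    rwa [show s.domRestrict g ⁻¹' B = (Subtype.val : s → ℝ) ⁻¹' (g ⁻¹' B) from rfl,
      Subtype.image_preimage_coe] at this
  have himg : B ∩ g '' s = g '' (s ∩ g ⁻¹' B) := by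
    rw [image_inter_preimage, inter_comm]
  rw [Measure.restrict_apply hB, Measure.map_apply_of_aemeasurable hgm' hB, withDensity_apply',
    Measure.restrict_restrict' hs, himg, inter_comm (g ⁻¹' B) s]
  exact hausdorffMeasure_image_eq_lintegral hg hinj hLc hLpos hd inter_subset_left hm

/-- Integration along an injective curve with respect to Hausdorff measure. -/
theorem setIntegral_hausdorffMeasure_image {X : Type*} [MetricSpace X] [MeasurableSpace X]
    [BorelSpace X] {g : ℝ → X} {L : ℝ → ℝ} {s : Set ℝ} (hs : MeasurableSet s)
    (hg : ContinuousOn g s) (hinj : InjOn g s) (hLc : ContinuousOn L s) (hLpos : ∀ t ∈ s, 0 < L t)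
    (hd : ∀ t ∈ s, Tendsto (fun x : ℝ × ℝ => dist (g x.1) (g x.2) / |x.1 - x.2|)
      (𝓝 (t, t) ⊓ 𝓟 {x | x.1 ≠ x.2}) (𝓝 (L t))) {φ : X → ℝ}
    (hφ : AEStronglyMeasurable φ ((Measure.hausdorffMeasure 1 : Measure X).restrict (g '' s))) :
    ∫ x in g '' s, φ x ∂(Measure.hausdorffMeasure 1) = ∫ t in s, L t * φ (g t) := by
  have hLm : AEMeasurable (fun t => ENNReal.ofReal (L t)) (volume.restrict s) :=
    (hLc.aemeasurable hs).ennreal_ofReal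
  have hgm' : AEMeasurable g ((volume.restrict s).withDensity fun t => ENNReal.ofReal (L t)) :=
    (hg.aemeasurable hs).mono_ac (withDensity_absolutelyContinuous _ _)
  have e := restrict_hausdorffMeasure_image hs hg hinj hLc hLpos hd
  rw [e] at hφ ⊢
  rw [integral_map hgm' hφ, integral_withDensity_eq_integral_toReal_smul₀ hLm (by simp)]
  refine setIntegral_congr_fun hs fun t ht => ?_
  simp only [ENNReal.toReal_ofReal (hLpos t ht).le, smul_eq_mul]

end PlaneGeometry

namespace PlaneGeometry

variable {k : ℝ} {p : Plane k} {K : Set (Plane k)}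

/-! ### The boundary of a region near a boundary point -/

/-- The surface of curvature `k` is locally the zero set of this function. -/
noncomputable def surfaceEq (k : ℝ) (x : Ambient) : ℝ :=
  if k = 0 then x 0 else k * form k x x - 1

theorem contDiff_surfaceEq {n : WithTop ℕ∞} (k : ℝ) : ContDiff ℝ n (surfaceEq k) := by
  unfold surfaceEq form
  split_ifs <;> fun_prop

theorem surfaceEq_val (p : Plane k) : surfaceEq k p.val = 0 := by
  have := p.isPoint
  unfold IsPoint at this
  unfold surfaceEq
  split_ifs at * with h
  · exact this
  · linarith [this.1]

/-- For `k < 0` the choice of the sheet `x 0 > 0` is an open condition, so locally only the equation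
matters. -/
theorem eventually_isPoint_iff (p : Plane k) :
    ∀ᶠ x in 𝓝 p.val, IsPoint k x ↔ surfaceEq k x = 0 := by
  by_cases hk : k < 0
  · have hp := p.isPoint
    rw [IsPoint, if_neg hk.ne] at hp
    have h0 : ∀ᶠ x : Ambient in 𝓝 p.val, 0 < x 0 :=
      (continuous_apply 0).continuousAt.eventually (lt_mem_nhds (hp.2 hk))
    filter_upwards [h0] with x hx
    rw [IsPoint, surfaceEq, if_neg hk.ne, if_neg hk.ne, sub_eq_zero]
    exact ⟨fun h => h.1, fun h => ⟨h, fun _ => hx⟩⟩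
  · refine Eventually.of_forall fun x => ?_
    unfold IsPoint surfaceEq
    split_ifs
    · rfl
    · rw [sub_eq_zero]
      exact ⟨fun h => h.1, fun h => ⟨h, fun h' => absurd h' hk⟩⟩

theorem hasDerivAt_line (x v : Ambient) : HasDerivAt (fun s : ℝ => x + s • v) v 0 := by
  simpa using ((hasDerivAt_id (0 : ℝ)).smul_const v).const_add x

theorem hasDerivAt_comp_line {f : Ambient → ℝ} {x : Ambient} (hf : DifferentiableAt ℝ f x)
    (v : Ambient) : HasDerivAt (fun s : ℝ => f (x + s • v)) (fderiv ℝ f x v) 0 := by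
  have h : HasFDerivAt f (fderiv ℝ f x) (x + (0 : ℝ) • v) := by simpa using hf.hasFDerivAt
  exact h.comp_hasDerivAt 0 (hasDerivAt_line x v)

theorem fderiv_surfaceEq_eq_zero_iff (p : Plane k) (v : Ambient) :
    fderiv ℝ (surfaceEq k) p.val v = 0 ↔ IsTangent p v := by
  have h := hasDerivAt_comp_line
    ((contDiff_surfaceEq (n := 1) k).differentiable one_ne_zero p.val) v
  unfold IsTangent
  have hl := hasDerivAt_line p.val v
  split_ifs with hk
  · subst hk
    have h1 := hasDerivAt_pi.1 hl 0
    have h2 : (fun s : ℝ => surfaceEq 0 (p.val + s • v)) = fun s => (p.val + s • v) 0 := by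
      simp [surfaceEq]
    rw [h2] at h
    rw [h.unique h1]
  · have h1 := ((hasDerivAt_form (k := k) hl hl).const_mul k).sub_const 1
    have h2 : (fun s : ℝ => surfaceEq k (p.val + s • v))
        = fun s => k * form k (p.val + s • v) (p.val + s • v) - 1 := by
      simp [surfaceEq, hk]
    rw [h2] at h
    rw [h.unique h1, form_comm k v]
    simp [hk]

/-- The counterclockwise rotation by 90°. -/
noncomputable def rotate (p : Plane k) (v : Ambient) : Ambient :=
  ![formSign k * (unitNormal p 1 * v 2 - unitNormal p 2 * v 1),
    unitNormal p 2 * v 0 - unitNormal p 0 * v 2, unitNormal p 0 * v 1 - unitNormal p 1 * v 0]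

theorem form_rotate (p : Plane k) (v w : Ambient) : form k (rotate p v) w = areaForm p v w := by
  rw [areaForm_eq]
  simp only [rotate, form_def, det₃, Matrix.cons_val_zero, Matrix.cons_val_one, Matrix.cons_val]
  linear_combination ((unitNormal p 1 * v 2 - unitNormal p 2 * v 1) * w 0) * formSign_mul_self k

theorem isTangent_rotate (p : Plane k) (v : Ambient) : IsTangent p (rotate p v) := by
  rw [isTangent_iff, form_comm, form_rotate, areaForm_eq]
  simp only [det₃]; ring

theorem areaForm_rotate_pos {v : Ambient} (hv : IsTangent p v) (h : v ≠ 0) :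
    0 < areaForm p v (rotate p v) := by
  rw [← form_rotate]
  refine (isTangent_rotate p v).form_pos fun h0 => ?_
  have hn := isTangent_iff.1 hv
  have hnn := form_unitNormal_self p
  have hs := formSign_mul_self k
  have c0 := congrFun h0 0
  have c1 := congrFun h0 1
  have c2 := congrFun h0 2
  simp only [rotate, Matrix.cons_val_zero, Matrix.cons_val_one, Matrix.cons_val,
    Pi.zero_apply] at c0 c1 c2
  have c0' : unitNormal p 1 * v 2 - unitNormal p 2 * v 1 = 0 := by
    linear_combination formSign k * c0 - (unitNormal p 1 * v 2 - unitNormal p 2 * v 1) * hs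
  rw [form_def] at hn hnn
  have s0 : formSign k ≠ 0 := fun h => by simp [h] at hs
  apply h
  funext i
  apply mul_left_cancel₀ s0
  -- The coordinates that follow are those of `n × (n × v) = n ⟨n, v⟩ - v ⟨n, n⟩`, with signs
  -- adapted to the form.
  set n := unitNormal p
  fin_cases i <;> simp only [Fin.zero_eta, Fin.mk_one, Fin.reduceFinMk, Pi.zero_apply, mul_zero]
  · linear_combination n 0 * hn - v 0 * hnn - n 1 * c2 + n 2 * c1
  · linear_combination n 1 * hn - v 1 * hnn + formSign k * n 0 * c2 - n 2 * c0'
  · linear_combination n 2 * hn - v 2 * hnn - formSign k * n 0 * c1 + n 1 * c0'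

theorem areaForm_swap (p : Plane k) (v w : Ambient) : areaForm p v w = -areaForm p w v := by
  simp only [areaForm_eq, det₃]; ring

theorem areaForm_self (p : Plane k) (v : Ambient) : areaForm p v v = 0 := by
  simp only [areaForm_eq, det₃]; ring

theorem areaForm_add_left (p : Plane k) (u v w : Ambient) :
    areaForm p (u + v) w = areaForm p u w + areaForm p v w := by
  simp only [areaForm_eq, det₃, Pi.add_apply]; ring

theorem areaForm_add_right (p : Plane k) (u v w : Ambient) :
    areaForm p u (v + w) = areaForm p u v + areaForm p u w := by
  simp only [areaForm_eq, det₃, Pi.add_apply]; ring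

theorem areaForm_smul_left (p : Plane k) (c : ℝ) (v w : Ambient) :
    areaForm p (c • v) w = c * areaForm p v w := by
  simp only [areaForm_eq, det₃, Pi.smul_apply, smul_eq_mul]; ring

theorem areaForm_smul_right (p : Plane k) (c : ℝ) (v w : Ambient) :
    areaForm p v (c • w) = c * areaForm p v w := by
  simp only [areaForm_eq, det₃, Pi.smul_apply, smul_eq_mul]; ring

/-- A basis of the tangent plane adapted to a nonzero covector. -/
theorem exists_adapted_basis {f' : Ambient →L[ℝ] ℝ} (hf : ∃ v, IsTangent p v ∧ f' v ≠ 0) :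
    ∃ T N, IsTangent p T ∧ IsTangent p N ∧ f' T = 0 ∧ f' N = -1 ∧ 0 < areaForm p T N := by
  obtain ⟨v, hv, hfv⟩ := hf
  set N := (-(f' v)⁻¹) • v
  have hN : IsTangent p N := hv.smul _
  have hfN : f' N = -1 := by simp [N, hfv]
  have hN0 : N ≠ 0 := fun h => by simp [h] at hfN
  -- Rotate `N` clockwise, then add the multiple of `N` that puts the result in the kernel of `f'`;
  -- this multiple does not change the area form with `N`.
  refine ⟨(-1 : ℝ) • rotate p N + (-f' (rotate p N)) • N, N, ?_, hN, ?_, hfN, ?_⟩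
  · exact ((isTangent_rotate p N).smul (-1)).add (hN.smul (-f' (rotate p N)))
  · rw [map_add, map_smul, map_smul, hfN]; simp
  · rw [areaForm_add_left, areaForm_smul_left, areaForm_smul_left, areaForm_self,
      areaForm_swap p (rotate p N) N]
    have := areaForm_rotate_pos hN hN0
    linarith

/-- A chart of the ambient space at `p` that straightens the surface and the level sets of `f`. -/
noncomputable def straighten (p : Plane k) (T : Ambient) (f : Ambient → ℝ) (x : Ambient) :
    Ambient :=
  ![form k (x - p.val) T, f x, surfaceEq k x]

theorem contDiffAt_straighten (T : Ambient) {f : Ambient → ℝ} {x : Ambient}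
    (hf : ContDiffAt ℝ 2 f x) : ContDiffAt ℝ 2 (straighten p T f) x := by
  refine contDiffAt_pi.2 fun i => ?_
  fin_cases i
  · have : ContDiff ℝ 2 fun x : Ambient => form k (x - p.val) T := by unfold form; fun_prop
    exact this.contDiffAt
  · exact hf
  · exact (contDiff_surfaceEq k).contDiffAt

/-- Injectivity suffices in equal dimensions. A vector in the kernel is tangent by the third
coordinate, parallel to `T` by the second, and orthogonal to `T` by the first, hence zero. -/
theorem exists_equiv_hasFDerivAt_straighten {T N : Ambient} {f : Ambient → ℝ}
    (hf : ContDiffAt ℝ 2 f p.val) (hT : IsTangent p T) (hN : IsTangent p N)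
    (hfT : fderiv ℝ f p.val T = 0) (hfN : fderiv ℝ f p.val N = -1) (hTN : 0 < areaForm p T N) :
    ∃ e : Ambient ≃L[ℝ] Ambient,
      HasFDerivAt (straighten p T f) (e : Ambient →L[ℝ] Ambient) p.val := by
  have hΦ := (contDiffAt_straighten (p := p) T hf).differentiableAt two_ne_zero
  set Φ' := fderiv ℝ (straighten p T f) p.val
  have hinj : Function.Injective Φ' := by
    refine (injective_iff_map_eq_zero Φ').2 fun v hv => ?_
    have hcurve : HasDerivAt (fun s : ℝ => straighten p T f (p.val + s • v)) (Φ' v) 0 := by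
      have h : HasFDerivAt (straighten p T f) Φ' (p.val + (0 : ℝ) • v) := by
        simpa using hΦ.hasFDerivAt
      exact h.comp_hasDerivAt 0 (hasDerivAt_line p.val v)
    rw [hv] at hcurve
    have h0 := hasDerivAt_pi.1 hcurve 0
    have h1 := hasDerivAt_pi.1 hcurve 1
    have h2 := hasDerivAt_pi.1 hcurve 2
    have e0 : form k v T = 0 := by
      have := hasDerivAt_form (k := k) ((hasDerivAt_line p.val v).sub_const p.val)
        (hasDerivAt_const (0 : ℝ) T)
      have := h0.unique this
      simpa [form_def] using this.symm
    have e1 : fderiv ℝ f p.val v = 0 :=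
      (hasDerivAt_comp_line (hf.differentiableAt two_ne_zero) v).unique h1
    have e2 : IsTangent p v := (fderiv_surfaceEq_eq_zero_iff p v).1
      ((hasDerivAt_comp_line ((contDiff_surfaceEq (n := 1) k).differentiable one_ne_zero p.val)
        v).unique h2)
    have hcr := hT.areaForm_smul_eq hN e2
    have e3 : areaForm p T v = 0 := by
      have := congrArg (fderiv ℝ f p.val) hcr
      rw [map_smul, map_add, map_smul, map_smul, e1, hfT, hfN] at this
      simpa using this
    rw [e3, zero_smul, add_zero] at hcr
    have hT0 : T ≠ 0 := fun h => by
      rw [h] at hTN; simp [areaForm_eq, det₃] at hTN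
    have e4 : areaForm p v N * form k T T = 0 := by
      rw [← form_smul_left, ← hcr, form_smul_left, e0, mul_zero]
    rcases mul_eq_zero.1 e4 with h | h
    · rw [h, zero_smul] at hcr
      exact (smul_eq_zero.1 hcr).resolve_left hTN.ne'
    · exact absurd h (hT.form_pos hT0).ne'
  refine ⟨(LinearEquiv.ofInjectiveEndo (Φ' : Ambient →ₗ[ℝ] Ambient) hinj).toContinuousLinearEquiv,
    ?_⟩
  exact hΦ.hasFDerivAt

open Classical in
/-- The point of the plane at a given position, and `p` if there is none. -/
noncomputable def toPlane (p : Plane k) (x : Ambient) : Plane k :=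
  if h : IsPoint k x then ⟨x, h⟩ else p

theorem toPlane_val {p : Plane k} {x : Ambient} (h : IsPoint k x) : (toPlane p x).val = x := by
  simp [toPlane, h]

theorem toPlane_eq {p q : Plane k} : toPlane p q.val = q := by
  simp [toPlane, q.isPoint]

/-- A closed `K` contains its frontier, and `f < 0` would make the point interior. -/
theorem eq_zero_of_mem_frontier {f : Ambient → ℝ} (hf : ContinuousAt f p.val)
    (hloc : ∀ᶠ q in 𝓝 p, q ∈ K ↔ f q.val ≤ 0) (hK : IsClosed K) (hp : p ∈ frontier K) :
    f p.val = 0 := by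
  have h1 : f p.val ≤ 0 := hloc.self_of_nhds.1 (hK.frontier_subset hp)
  refine le_antisymm h1 (not_lt.1 fun hlt => hp.2 ?_)
  have hc : ContinuousAt (fun q : Plane k => f q.val) p :=
    hf.comp (continuous_val k).continuousAt
  rw [mem_interior_iff_mem_nhds]
  filter_upwards [hloc, hc.eventually (gt_mem_nhds hlt)] with q hq hq' using hq.2 hq'.le

theorem eventually_nhds_val {f : Ambient → ℝ} (h1 : ∀ᶠ q in 𝓝 p, q ∈ K ↔ f q.val ≤ 0) :
    ∀ᶠ x in 𝓝 p.val, ∀ q : Plane k, q.val = x → (q ∈ K ↔ f x ≤ 0) := by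
  rw [(isInducing_val k).nhds_eq_comap, eventually_comap] at h1
  filter_upwards [h1] with x hx q hq
  rw [hx q hq, hq]

/-- A parametrized piece of the boundary of `K` around `p`, together with a curve that leaves `K`
transversally at `p`. -/
structure BoundaryChart (K : Set (Plane k)) (p : Plane k) where
  /-- half the length of the parameter interval -/
  δ : ℝ
  δ_pos : 0 < δ
  /-- the parametrization -/
  arc : ℝ → Plane k
  /-- the direction of the coordinate that serves as parameter -/
  dir : Ambient
  /-- an open set of the ambient space in which the arc is the whole boundary -/
  nbhd : Set Ambient
  isOpen_nbhd : IsOpen nbhd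
  mem_nbhd : p.val ∈ nbhd
  contDiffAt : ∀ t ∈ Icc (-δ) δ, ContDiffAt ℝ 2 (fun s => (arc s).val) t
  coord : ∀ t ∈ Icc (-δ) δ, form k ((arc t).val - p.val) dir = t
  velocity_ne_zero : ∀ t ∈ Icc (-δ) δ, velocity arc t ≠ 0
  image_eq : arc '' Ioo (-δ) δ = frontier K ∩ Plane.val ⁻¹' nbhd
  left_notMem : (arc (-δ)).val ∉ nbhd
  right_notMem : (arc δ).val ∉ nbhd
  isBoundaryArc : ∀ t ∈ Ioo (-δ) δ, IsBoundaryArc K (arc t) fun s => arc (t + s)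
  exists_outward : ∃ (β : ℝ → Plane k) (w : Ambient), β 0 = p ∧
    HasDerivAt (fun s => (β s).val) w 0 ∧ (∀ᶠ s in 𝓝[>] 0, β s ∉ K) ∧
    areaForm p (velocity arc 0) w < 0

end PlaneGeometry

/-! ### Construction of boundary charts -/

namespace PlaneGeometry

variable {k : ℝ} {p : Plane k} {K : Set (Plane k)}

theorem norm_vec₃_lt_iff {a b c r : ℝ} :
    ‖(![a, b, c] : Ambient)‖ < r ↔ |a| < r ∧ |b| < r ∧ |c| < r := by
  by_cases hr : 0 < r
  · rw [pi_norm_lt_iff hr]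
    simp [Fin.forall_fin_succ]
  · exact ⟨fun h => absurd ((norm_nonneg _).trans_lt h) hr,
      fun h => absurd ((abs_nonneg _).trans_lt h.1) hr⟩

theorem continuous_areaForm (k : ℝ) : Continuous
    fun x : Plane k × Ambient × Ambient => areaForm x.1 x.2.1 x.2.2 := by
  have hn : Continuous fun q : Plane k => unitNormal q := by
    unfold unitNormal
    split_ifs
    · exact continuous_const
    · exact (continuous_val k).const_smul √|k|
  simp only [areaForm_eq, det₃]
  fun_prop

/-- A local inverse of `straighten`. -/
theorem exists_local_inverse {T N : Ambient} {f : Ambient → ℝ}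
    (hf : ContDiffAt ℝ 2 f p.val) (hf0 : f p.val = 0) (hT : IsTangent p T) (hN : IsTangent p N)
    (hfT : fderiv ℝ f p.val T = 0) (hfN : fderiv ℝ f p.val N = -1) (hTN : 0 < areaForm p T N) :
    ∃ Ψ : Ambient → Ambient, Ψ 0 = p.val ∧ ContDiffAt ℝ 2 Ψ 0 ∧
      (∀ᶠ y in 𝓝 0, straighten p T f (Ψ y) = y) ∧
      ∀ᶠ x in 𝓝 p.val, Ψ (straighten p T f x) = x := by
  obtain ⟨e, he⟩ := exists_equiv_hasFDerivAt_straighten hf hT hN hfT hfN hTN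
  have hΦ := contDiffAt_straighten (p := p) T hf
  have h0 : straighten p T f p.val = 0 := by
    funext i
    fin_cases i <;> simp [straighten, hf0, surfaceEq_val, form_def]
  have hs := hΦ.hasStrictFDerivAt' he two_ne_zero
  refine ⟨hΦ.localInverse he two_ne_zero, ?_, ?_, ?_, ?_⟩
  · rw [← h0]; exact hΦ.localInverse_apply_image he two_ne_zero
  · rw [← h0]; exact hΦ.to_localInverse he two_ne_zero
  · rw [← h0]; exact hs.eventually_right_inverse
  · exact hs.eventually_left_inverse

/-- In the straightened coordinates `(t, s, u)` the surface is `u = 0`, the region is `s ≤ 0` and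
the boundary is the `t`-axis. The arc is the image of that axis under the inverse chart, and the
image of the positive `s`-axis leaves `K`. -/
theorem nonempty_boundaryChart (hK : IsClosed K) (hC : HasC2Boundary K) (hp : p ∈ frontier K) :
    Nonempty (BoundaryChart K p) := by
  obtain ⟨f, hf, hdf, hloc⟩ := hC p hp
  obtain ⟨T, N, hT, hN, hfT, hfN, hTN⟩ := exists_adapted_basis hdf
  have hf0 := eq_zero_of_mem_frontier hf.continuousAt hloc hK hp
  obtain ⟨Ψ, hΨ0, hΨc, hr, hl⟩ := exists_local_inverse hf hf0 hT hN hfT hfN hTN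
  obtain ⟨W, hW, hWo, hpW⟩ := eventually_nhds_iff.1 (hl.and ((hf.eventually (by simp)).and
    ((eventually_isPoint_iff p).and (eventually_nhds_val hloc))))
  have hΨW : ∀ᶠ y in 𝓝 0, Ψ y ∈ W := by
    refine hΨc.continuousAt.eventually ?_
    rw [hΨ0]; exact hWo.mem_nhds hpW
  obtain ⟨ε, hε, hball⟩ := Metric.eventually_nhds_iff_ball.1
    ((hΨc.eventually (by simp)).and (hr.and hΨW))
  replace hball : ∀ t s : ℝ, |t| < ε → |s| < ε → ContDiffAt ℝ 2 Ψ ![t, s, 0] ∧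
      straighten p T f (Ψ ![t, s, 0]) = ![t, s, 0] ∧ Ψ ![t, s, 0] ∈ W := fun t s ht hs =>
    hball _ (by rw [mem_ball_zero_iff, norm_vec₃_lt_iff]; simp [ht, hs, hε])
  have hform : ∀ t s : ℝ, |t| < ε → |s| < ε → form k (Ψ ![t, s, 0] - p.val) T = t :=
    fun t s ht hs => congrFun (hball t s ht hs).2.1 0
  have hfΨ : ∀ t s : ℝ, |t| < ε → |s| < ε → f (Ψ ![t, s, 0]) = s :=
    fun t s ht hs => congrFun (hball t s ht hs).2.1 1
  have hpt : ∀ t s : ℝ, |t| < ε → |s| < ε → IsPoint k (Ψ ![t, s, 0]) := fun t s ht hs =>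
    ((hW _ (hball t s ht hs).2.2).2.2.1).2 (congrFun (hball t s ht hs).2.1 2)
  -- A two-parameter chart of the surface; the fallback value of `toPlane` does not occur for
  -- parameters below `ε`.
  set σ : ℝ → ℝ → Plane k := fun t s => toPlane p (Ψ ![t, s, 0])
  have hσ : ∀ t s : ℝ, |t| < ε → |s| < ε → (σ t s).val = Ψ ![t, s, 0] := fun t s ht hs =>
    toPlane_val (hpt t s ht hs)
  have hσK : ∀ t s : ℝ, |t| < ε → |s| < ε → (σ t s ∈ K ↔ s ≤ 0) := fun t s ht hs => by
    rw [(hW _ (hball t s ht hs).2.2).2.2.2 _ (hσ t s ht hs), hfΨ t s ht hs]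
  have hnear : ∀ t : ℝ, |t| < ε → ∀ᶠ s in 𝓝 t, |s| < ε := fun t ht =>
    continuous_abs.continuousAt.eventually (gt_mem_nhds ht)
  have h0ε : |(0 : ℝ)| < ε := by simpa using hε
  -- the derivatives of `σ`
  have hd1 : ∀ t : ℝ, HasDerivAt (fun s : ℝ => (![s, 0, 0] : Ambient)) ![1, 0, 0] t := by
    intro t
    refine hasDerivAt_pi.2 fun i => ?_
    fin_cases i
    · exact hasDerivAt_id t
    · exact hasDerivAt_const t 0
    · exact hasDerivAt_const t 0
  have hd2 : ∀ t : ℝ, HasDerivAt (fun s : ℝ => (![t, s, 0] : Ambient)) ![0, 1, 0] 0 := by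
    intro t
    refine hasDerivAt_pi.2 fun i => ?_
    fin_cases i
    · exact hasDerivAt_const 0 t
    · exact hasDerivAt_id 0
    · exact hasDerivAt_const 0 0
  set g : ℝ → Plane k := fun t => σ t 0
  set w : ℝ → Ambient := fun t => fderiv ℝ Ψ ![t, 0, 0] ![0, 1, 0]
  have hgc : ∀ t, |t| < ε → ContDiffAt ℝ 2 (fun s => (g s).val) t := by
    intro t ht
    have hvec : ContDiff ℝ 2 fun s : ℝ => (![s, 0, 0] : Ambient) := by
      refine contDiff_pi.2 fun i => ?_
      fin_cases i
      · exact contDiff_id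
      · exact contDiff_const
      · exact contDiff_const
    refine ((hball t 0 ht h0ε).1.comp t hvec.contDiffAt).congr_of_eventuallyEq ?_
    filter_upwards [hnear t ht] with s hs using hσ s 0 hs h0ε
  have hσd : ∀ t, |t| < ε → HasDerivAt (fun s => (σ t s).val) (w t) 0 := by
    intro t ht
    have h1 := ((hball t 0 ht h0ε).1.differentiableAt two_ne_zero).hasFDerivAt.comp_hasDerivAt 0
      (hd2 t)
    refine h1.congr_of_eventuallyEq ?_
    filter_upwards [hnear 0 h0ε] with s hs using hσ t s ht hs
  have hvT : ∀ t, |t| < ε → form k (velocity g t) T = 1 := by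
    intro t ht
    have h1 := hasDerivAt_form (k := k) ((hasDerivAt_velocity_of (hgc t ht)).sub_const p.val)
      (hasDerivAt_const t T)
    have h2 : (fun s => form k ((g s).val - p.val) T) =ᶠ[𝓝 t] fun s => s := by
      filter_upwards [hnear t ht] with s hs
      rw [show (g s).val = _ from hσ s 0 hs h0ε, hform s 0 hs h0ε]
    have := (h1.congr_of_eventuallyEq h2.symm).unique (hasDerivAt_id t)
    simpa [form_def] using this
  have hfW : ∀ t, |t| < ε → HasFDerivAt f (fderiv ℝ f (g t).val) (g t).val := by
    intro t ht
    rw [show (g t).val = _ from hσ t 0 ht h0ε]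
    exact ((hW _ (hball t 0 ht h0ε).2.2).2.1.differentiableAt two_ne_zero).hasFDerivAt
  have hfv : ∀ t, |t| < ε → fderiv ℝ f (g t).val (velocity g t) = 0 := by
    intro t ht
    have h1 := (hfW t ht).comp_hasDerivAt t (hasDerivAt_velocity_of (hgc t ht))
    have h2 : (fun _ => (0 : ℝ)) =ᶠ[𝓝 t] f ∘ fun s => (g s).val := by
      filter_upwards [hnear t ht] with s hs
      rw [Function.comp_apply, show (g s).val = _ from hσ s 0 hs h0ε, hfΨ s 0 hs h0ε]
    exact (h1.congr_of_eventuallyEq h2).unique (hasDerivAt_const t 0)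
  have hfw : ∀ t, |t| < ε → fderiv ℝ f (g t).val (w t) = 1 := by
    intro t ht
    have h1 := (hfW t ht).comp_hasDerivAt 0 (hσd t ht)
    have h2 : (fun s : ℝ => s) =ᶠ[𝓝 0] f ∘ fun s => (σ t s).val := by
      filter_upwards [hnear 0 h0ε] with s hs
      rw [Function.comp_apply, hσ t s ht hs, hfΨ t s ht hs]
    exact (h1.congr_of_eventuallyEq h2).unique (hasDerivAt_id 0)
  have hwt : ∀ t, |t| < ε → IsTangent (g t) (w t) := fun t ht =>
    isTangent_of_hasDerivAt (γ := σ t) (hσd t ht)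
  have hvt : ∀ t, |t| < ε → IsTangent (g t) (velocity g t) := fun t ht =>
    isTangent_velocity (hgc t ht)
  have hg0 : g 0 = p := by
    have : Ψ ![0, 0, 0] = p.val := by
      rw [← hΨ0]; congr 1; funext i; fin_cases i <;> rfl
    change toPlane p (Ψ ![0, 0, 0]) = p
    rw [this, toPlane_eq]
  -- orientation
  have harea0 : areaForm p (velocity g 0) (w 0) < 0 := by
    have v1 := hT.areaForm_smul_eq hN (hg0 ▸ hvt 0 h0ε)
    have w1 := hT.areaForm_smul_eq hN (hg0 ▸ hwt 0 h0ε)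
    have v2 := congrArg (fderiv ℝ f p.val) v1
    have w2 := congrArg (fderiv ℝ f p.val) w1
    have v3 := hfv 0 h0ε
    have w3 := hfw 0 h0ε
    rw [hg0] at v3 w3
    rw [map_smul, map_add, map_smul, map_smul, hfT, hfN, v3] at v2
    rw [map_smul, map_add, map_smul, map_smul, hfT, hfN, w3] at w2
    simp only [smul_eq_mul, mul_zero, zero_add, mul_one] at v2 w2
    have v4 : areaForm p T (velocity g 0) = 0 := by linarith
    rw [v4, zero_smul, add_zero] at v1
    have hT0 : T ≠ 0 := fun h => by
      rw [h] at hTN; simp [areaForm_eq, det₃] at hTN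
    have hTT := hT.form_pos hT0
    have v5 : areaForm p T N * 1 = areaForm p (velocity g 0) N * form k T T := by
      rw [← hvT 0 h0ε, ← form_smul_left, v1, form_smul_left]
    have v6 : 0 < areaForm p (velocity g 0) N := by
      by_contra hc
      have := mul_nonpos_of_nonpos_of_nonneg (not_lt.1 hc) hTT.le
      linarith
    have v7 := congrArg (fun x => areaForm p x (w 0)) v1
    simp only [areaForm_smul_left] at v7
    have v8 : areaForm p T (w 0) < 0 := by linarith
    by_contra hc
    have h1 := mul_nonneg hTN.le (not_lt.1 hc)
    have h2 := mul_neg_of_pos_of_neg v6 v8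
    linarith
  -- The outward direction `w` stays to the right of the velocity near `0`, so the whole shortened
  -- arc is positively directed.
  have hev : ∀ᶠ t in 𝓝 0, areaForm (g t) (velocity g t) (w t) < 0 := by
    have hfd : ContinuousAt (fun t : ℝ => fderiv ℝ Ψ ![t, 0, 0]) 0 := by
      have h1 : ContinuousAt (fderiv ℝ Ψ) ![0, 0, 0] :=
        ((hball 0 0 h0ε h0ε).1.fderiv_right (m := 1) (by norm_num)).continuousAt
      exact ContinuousAt.comp (f := fun t : ℝ => (![t, 0, 0] : Ambient)) h1 (hd1 0).continuousAt
    have hgcont : ContinuousAt g 0 :=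
      (isInducing_val k).continuousAt_iff.2 (hgc 0 h0ε).continuousAt
    have hvcont : ContinuousAt (velocity g) 0 := (contDiffAt_velocity (hgc 0 h0ε)).continuousAt
    have hwcont : ContinuousAt w 0 := hfd.clm_apply continuousAt_const
    have hcont : ContinuousAt (fun t => areaForm (g t) (velocity g t) (w t)) 0 :=
      ContinuousAt.comp (f := fun t => (g t, velocity g t, w t))
        (continuous_areaForm k).continuousAt (hgcont.prodMk (hvcont.prodMk hwcont))
    refine hcont.eventually (gt_mem_nhds ?_)
    simpa only [hg0] using harea0
  obtain ⟨η, hη, hηa⟩ := Metric.eventually_nhds_iff_ball.1 hev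
  have hfr : ∀ t, |t| < ε → g t ∈ frontier K := by
    intro t ht
    refine ⟨subset_closure ((hσK t 0 ht h0ε).2 le_rfl), fun hint => ?_⟩
    have hc : ContinuousAt (fun s => σ t s) 0 :=
      (isInducing_val k).continuousAt_iff.2 (hσd t ht).continuousAt
    have h1 : ∀ᶠ s in 𝓝[>] (0 : ℝ), σ t s ∈ interior K :=
      (hc.eventually (isOpen_interior.mem_nhds hint)).filter_mono nhdsWithin_le_nhds
    obtain ⟨s, hs1, hs2, hs3⟩ := (h1.and (((hnear 0 h0ε).filter_mono nhdsWithin_le_nhds).and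
      self_mem_nhdsWithin)).exists
    exact absurd ((hσK t s ht hs2).1 (interior_subset hs1)) (not_le.2 hs3)
  -- Strictly below `ε`, so that the arc is still regular at the endpoints `±δ`; cutting the
  -- neighbourhood with the ball of radius `δ` leaves exactly these endpoints outside.
  obtain ⟨δ, hδ0, hδ⟩ : ∃ δ, 0 < δ ∧ δ < min ε η := exists_between (lt_min hε hη)
  have hIcc : ∀ t ∈ Icc (-δ) δ, |t| < ε := fun t ht =>
    (abs_le.2 ht).trans_lt (hδ.trans_le (min_le_left _ _))
  have hIoo : ∀ t ∈ Ioo (-δ) δ, |t| < ε := fun t ht => hIcc t (Ioo_subset_Icc_self ht)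
  have hΦW : ContinuousOn (straighten p T f) W := fun x hx =>
    (contDiffAt_straighten T (hW x hx).2.1).continuousAt.continuousWithinAt
  have hmem : ∀ t, |t| < ε → ((g t).val ∈ W ∩ straighten p T f ⁻¹' Metric.ball 0 δ ↔ |t| < δ) := by
    intro t ht
    rw [show (g t).val = _ from hσ t 0 ht h0ε, mem_inter_iff, mem_preimage,
      (hball t 0 ht h0ε).2.1, mem_ball_zero_iff, norm_vec₃_lt_iff]
    simp only [abs_zero]
    exact ⟨fun h => h.2.1, fun h => ⟨(hball t 0 ht h0ε).2.2, h, hδ0, hδ0⟩⟩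
  refine ⟨{
    δ := δ, δ_pos := hδ0, arc := g, dir := T
    nbhd := W ∩ straighten p T f ⁻¹' Metric.ball 0 δ
    isOpen_nbhd := hΦW.isOpen_inter_preimage hWo Metric.isOpen_ball
    mem_nbhd := ?_
    contDiffAt := fun t ht => hgc t (hIcc t ht)
    coord := fun t ht => ?_
    velocity_ne_zero := fun t ht h0 => ?_
    image_eq := ?_
    left_notMem := ?_
    right_notMem := ?_
    isBoundaryArc := ?_
    exists_outward := ?_ }⟩
  · have := (hmem 0 h0ε).2 (by simpa using hδ0)
    rwa [hg0] at this
  · rw [show (g t).val = _ from hσ t 0 (hIcc t ht) h0ε, hform t 0 (hIcc t ht) h0ε]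
  · have := hvT t (hIcc t ht)
    rw [h0] at this
    simp [form_def] at this
  · apply Subset.antisymm
    · rintro _ ⟨t, ht, rfl⟩
      exact ⟨hfr t (hIoo t ht), (hmem t (hIoo t ht)).2 (abs_lt.2 ht)⟩
    · rintro q ⟨hq, hqW, hqδ⟩
      have hqloc : ∀ᶠ q' in 𝓝 q, q' ∈ K ↔ f q'.val ≤ 0 := by
        filter_upwards [(continuous_val k).continuousAt.eventually (hWo.mem_nhds hqW)] with q' hq'
        exact (hW _ hq').2.2.2 q' rfl
      have hfq := eq_zero_of_mem_frontier (hW _ hqW).2.1.continuousAt hqloc hK hq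
      have hst : straighten p T f q.val = ![form k (q.val - p.val) T, 0, 0] := by
        rw [straighten, hfq, surfaceEq_val]
      rw [mem_preimage, hst, mem_ball_zero_iff, norm_vec₃_lt_iff] at hqδ
      refine ⟨form k (q.val - p.val) T, abs_lt.1 hqδ.1, ?_⟩
      change toPlane p (Ψ ![form k (q.val - p.val) T, 0, 0]) = q
      rw [← hst, (hW _ hqW).1, toPlane_eq]
  · rw [hmem (-δ) (hIcc _ ⟨le_rfl, by linarith⟩), abs_neg, abs_of_pos hδ0]
    exact lt_irrefl δ
  · rw [hmem δ (hIcc _ ⟨by linarith, le_rfl⟩), abs_of_pos hδ0]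
    exact lt_irrefl δ
  · intro t ht
    have htε := hIoo t ht
    have hvs : velocity (fun s => g (t + s)) 0 = velocity g t := by
      have := deriv_comp_const_add (f := fun s => (g s).val) t 0
      rw [add_zero] at this
      exact this
    have harea : areaForm (g t) (velocity g t) (w t) < 0 := by
      refine hηa t ?_
      rw [mem_ball_zero_iff, Real.norm_eq_abs]
      exact (abs_lt.2 ht).trans (hδ.trans_le (min_le_right _ _))
    have hgW : (g t).val ∈ W := ((hmem t htε).2 (abs_lt.2 ht)).1
    refine ⟨by simp, ?_, ?_, ?_, f, ⟨(hW _ hgW).2.1, ⟨w t, hwt t htε, ?_⟩, ?_⟩, ?_⟩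
    · have h1 : ContDiffAt ℝ 2 (fun s => (g s).val) (t + 0) := by rw [add_zero]; exact hgc t htε
      exact h1.comp (0 : ℝ) (contDiff_const.add contDiff_id).contDiffAt
    · rw [hvs]
      intro h0
      have := hvT t htε
      rw [h0] at this
      simp [form_def] at this
    · have hc : Tendsto (fun s : ℝ => t + s) (𝓝 0) (𝓝 t) := by
        have : Continuous fun s : ℝ => t + s := by fun_prop
        simpa using this.tendsto 0
      filter_upwards [hc.eventually (hnear t htε)] with s hs using hfr _ hs
    · rw [hfw t htε]; exact one_ne_zero
    · filter_upwards [(continuous_val k).continuousAt.eventually (hWo.mem_nhds hgW)] with q' hq'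
      exact (hW _ hq').2.2.2 q' rfl
    · intro v hv hpos
      rw [hvs] at hpos
      -- Apply the differential of `f` to Cramer's rule for `v` in the basis `velocity, w`: it kills
      -- the velocity and is `1` on `w`, so its sign on `v` is read off from the area forms.
      have h1 := congrArg (fderiv ℝ f (g t).val)
        ((hvt t htε).areaForm_smul_eq (hwt t htε) hv)
      rw [map_smul, map_add, map_smul, map_smul, hfv t htε, hfw t htε] at h1
      simp only [smul_eq_mul, mul_zero, zero_add, mul_one] at h1
      by_contra hc
      have := mul_nonpos_of_nonpos_of_nonneg harea.le (not_lt.1 hc)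
      linarith
  · refine ⟨σ 0, w 0, hg0, hσd 0 h0ε, ?_, harea0⟩
    filter_upwards [(hnear 0 h0ε).filter_mono nhdsWithin_le_nhds, self_mem_nhdsWithin] with s hs hs'
    rw [hσK 0 s h0ε hs]
    exact not_le.2 hs'

end PlaneGeometry

namespace PlaneGeometry

variable {k : ℝ} {p : Plane k} {K : Set (Plane k)}

/-! ### The tangent and the curvature of the boundary -/

theorem velocity_comp_const_add (γ : ℝ → Plane k) (t : ℝ) :
    velocity (fun s => γ (t + s)) = fun s => velocity γ (t + s) :=
  funext fun s => deriv_comp_const_add (f := fun s => (γ s).val) t s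

theorem geodesicCurvature_comp_const_add (γ : ℝ → Plane k) (t : ℝ) :
    geodesicCurvature (fun s => γ (t + s)) 0 = geodesicCurvature γ t := by
  have h : acceleration (fun s => γ (t + s)) 0 = acceleration γ t := by
    have := deriv_comp_const_add (f := velocity γ) t 0
    rw [add_zero] at this
    rw [acceleration, velocity_comp_const_add]
    exact this
  simp only [geodesicCurvature, h, velocity_comp_const_add, add_zero]

/-- The unit tangent of a regular curve. -/
noncomputable def unitTangent (γ : ℝ → Plane k) (t : ℝ) : Ambient :=
  (length k (velocity γ t))⁻¹ • velocity γ t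

/-- A defining function has nonnegative derivative along a curve that leaves `K` at a boundary
point. -/
theorem fderiv_nonneg_of_curve {f : Ambient → ℝ} (hK : IsClosed K) (hp : p ∈ frontier K)
    (hf : IsLocalDefiningFunction K p f) {β : ℝ → Plane k} {w : Ambient} (hβ0 : β 0 = p)
    (hβ : HasDerivAt (fun s => (β s).val) w 0) (hβK : ∀ᶠ s in 𝓝[>] 0, β s ∉ K) :
    0 ≤ fderiv ℝ f p.val w := by
  have hf0 := eq_zero_of_mem_frontier hf.1.continuousAt hf.2.2 hK hp
  have h1 : HasFDerivAt f (fderiv ℝ f p.val) (β 0).val := by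
    rw [hβ0]; exact (hf.1.differentiableAt two_ne_zero).hasFDerivAt
  have h2 := (h1.comp_hasDerivAt 0 hβ).tendsto_slope_zero_right
  have hc : ContinuousAt β 0 := (isInducing_val k).continuousAt_iff.2 hβ.continuousAt
  have h3 : ∀ᶠ s in 𝓝[>] (0 : ℝ), β s ∈ K ↔ f (β s).val ≤ 0 := by
    have := hf.2.2
    rw [← hβ0] at this
    exact (hc.eventually this).filter_mono nhdsWithin_le_nhds
  refine ge_of_tendsto h2 ?_
  filter_upwards [h3, hβK, self_mem_nhdsWithin] with s hs hs' hs0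
  simp only [zero_add, Function.comp_apply, smul_eq_mul, hβ0, hf0, sub_zero]
  rw [hs, not_le] at hs'
  have hs0 : 0 < s := hs0
  positivity

theorem BoundaryChart.arc_zero (c : BoundaryChart K p) (hp : p ∈ frontier K) : c.arc 0 = p := by
  have h : p ∈ c.arc '' Ioo (-c.δ) c.δ := by
    rw [c.image_eq]; exact ⟨hp, c.mem_nbhd⟩
  obtain ⟨t, ht, h⟩ := h
  have := c.coord t (Ioo_subset_Icc_self ht)
  rw [h, sub_self] at this
  have h0 : t = 0 := by simpa [form_def] using this.symm
  rwa [h0] at h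

theorem BoundaryChart.arc_coord (c : BoundaryChart K p) {q : Plane k} (hq : q ∈ frontier K)
    (hq' : q.val ∈ c.nbhd) : form k (q.val - p.val) c.dir ∈ Ioo (-c.δ) c.δ ∧
      c.arc (form k (q.val - p.val) c.dir) = q := by
  have h : q ∈ c.arc '' Ioo (-c.δ) c.δ := by
    rw [c.image_eq]; exact ⟨hq, hq'⟩
  obtain ⟨t, ht, h⟩ := h
  have := c.coord t (Ioo_subset_Icc_self ht)
  rw [h] at this
  rw [this]
  exact ⟨ht, h⟩

/-- Near `p` the curve `γ` is `c.arc ∘ σ` for a `C²` function `σ`, the chart coordinate read along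
`γ`. Unit tangent and curvature are invariant under reparametrizations with positive derivative, and
the orientation condition forces `σ' > 0`. -/
theorem BoundaryChart.eq_of_isBoundaryArc (c : BoundaryChart K p) (hK : IsClosed K)
    (hp : p ∈ frontier K) {γ : ℝ → Plane k} (hγ : IsBoundaryArc K p γ) :
    unitTangent γ 0 = unitTangent c.arc 0 ∧
      geodesicCurvature γ 0 = geodesicCurvature c.arc 0 := by
  obtain ⟨hγ0, hγc, hγv, hγK, f, hf, hfγ⟩ := hγ
  have harc0 := c.arc_zero hp
  set σ : ℝ → ℝ := fun s => form k ((γ s).val - p.val) c.dir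
  have hσc : ContDiffAt ℝ 2 σ 0 := by
    have h1 : ContDiff ℝ 2 fun x : Ambient => form k (x - p.val) c.dir := by
      unfold form; fun_prop
    exact h1.contDiffAt.comp (0 : ℝ) hγc
  have hσ0 : σ 0 = 0 := by simp [σ, hγ0, form_def]
  have hval : ∀ᶠ s in 𝓝 (0 : ℝ), (γ s).val ∈ c.nbhd :=
    hγc.continuousAt.eventually (c.isOpen_nbhd.mem_nhds (by simpa only [hγ0] using c.mem_nbhd))
  have hγσ : ∀ᶠ s in 𝓝 (0 : ℝ), σ s ∈ Ioo (-c.δ) c.δ ∧ c.arc (σ s) = γ s := by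
    filter_upwards [hval, hγK] with s hs hs' using c.arc_coord hs' hs
  have h0mem : (0 : ℝ) ∈ Icc (-c.δ) c.δ := ⟨by linarith [c.δ_pos], c.δ_pos.le⟩
  have hσd : ∀ᶠ s in 𝓝 (0 : ℝ), DifferentiableAt ℝ σ s :=
    (hσc.eventually (by simp)).mono fun s hs => hs.differentiableAt two_ne_zero
  have hvel : ∀ᶠ s in 𝓝 (0 : ℝ), velocity γ s = deriv σ s • velocity c.arc (σ s) := by
    filter_upwards [hγσ.eventually_nhds, hσd] with s hs hs'
    have h1 := hasDerivAt_velocity_of (c.contDiffAt _ (Ioo_subset_Icc_self hs.self_of_nhds.1))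
    have h2 := HasDerivAt.scomp s h1 hs'.hasDerivAt
    refine HasDerivAt.deriv (h2.congr_of_eventuallyEq ?_)
    filter_upwards [hs] with u hu
    rw [Function.comp_apply, hu.2]
  have hvel0 := hvel.self_of_nhds
  rw [hσ0] at hvel0
  -- The term with the second derivative of `σ` is parallel to the velocity, so the area form in the
  -- curvature ignores it.
  have hacc : acceleration γ 0 = deriv σ 0 • (deriv σ 0 • acceleration c.arc 0)
      + deriv (deriv σ) 0 • velocity c.arc 0 := by
    have h1 : HasDerivAt (velocity c.arc) (acceleration c.arc (σ 0)) (σ 0) := by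
      rw [hσ0]; exact hasDerivAt_acceleration (c.contDiffAt 0 h0mem)
    have h2 := HasDerivAt.scomp 0 h1 hσd.self_of_nhds.hasDerivAt
    have h3 : HasDerivAt (deriv σ) (deriv (deriv σ) 0) 0 := by
      have h4 := hσc.fderiv_right (m := 1) (by norm_num)
      have h5 : ContDiffAt ℝ 1 (fun s => fderiv ℝ σ s 1) 0 := h4.clm_apply contDiffAt_const
      exact (h5.differentiableAt one_ne_zero).hasDerivAt
    have h6 := (h3.smul h2).congr_of_eventuallyEq hvel
    have h7 := h6.deriv
    rw [Function.comp_apply, hσ0] at h7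
    exact h7
  have hσ'0 : deriv σ 0 ≠ 0 := fun h => hγv (by rw [hvel0, h, zero_smul])
  have hpos : 0 < deriv σ 0 := by
    by_contra hneg
    have hneg' : deriv σ 0 < 0 := lt_of_le_of_ne (not_lt.1 hneg) hσ'0
    -- If `σ' < 0`, the outward direction `w` would lie to the left of `γ'`, where the differential
    -- of `f` is negative; but along a curve leaving `K` it is nonnegative.
    obtain ⟨β, w, hβ0, hβ, hβK, hw⟩ := c.exists_outward
    have hwt : IsTangent p w := hβ0 ▸ isTangent_of_hasDerivAt hβ
    have h1 := fderiv_nonneg_of_curve hK hp hf hβ0 hβ hβK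
    have h2 := hfγ w hwt (by
      rw [hvel0, areaForm_smul_left]; exact mul_pos_of_neg_of_neg hneg' hw)
    exact absurd h1 (not_le.2 h2)
  constructor
  · rw [unitTangent, unitTangent, hvel0, length_smul, abs_of_pos hpos, smul_smul]
    congr 1
    field_simp
  · rw [geodesicCurvature, geodesicCurvature, hvel0, hacc, hγ0, harc0, length_smul,
      abs_of_pos hpos]
    simp only [areaForm_smul_left, areaForm_add_right, areaForm_smul_right, areaForm_self]
    rw [mul_pow, ← mul_div_mul_left (areaForm p (velocity c.arc 0) (acceleration c.arc 0))
      (length k (velocity c.arc 0) ^ 3) (pow_ne_zero 3 hσ'0)]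
    congr 1
    ring

theorem BoundaryChart.arc_mem (c : BoundaryChart K p) {t : ℝ} (ht : t ∈ Ioo (-c.δ) c.δ) :
    c.arc t ∈ frontier K ∧ (c.arc t).val ∈ c.nbhd := by
  have h : c.arc t ∈ c.arc '' Ioo (-c.δ) c.δ := mem_image_of_mem _ ht
  rwa [c.image_eq] at h

/-- The chosen arc at `c.arc t` and the shifted arc of `c` are both compared with a chart centred at
`c.arc t`. -/
theorem BoundaryChart.boundary_eq (c : BoundaryChart K p) (hK : IsClosed K)
    (hC : HasC2Boundary K) {t : ℝ} (ht : t ∈ Ioo (-c.δ) c.δ) :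
    boundaryTangent K (c.arc t) = unitTangent c.arc t ∧
      boundaryCurvature K (c.arc t) = geodesicCurvature c.arc t := by
  have hfr : c.arc t ∈ frontier K := (c.arc_mem ht).1
  obtain ⟨c'⟩ := nonempty_boundaryChart hK hC hfr
  have harc := c.isBoundaryArc t ht
  have hex : ∃ γ, IsBoundaryArc K (c.arc t) γ := ⟨_, harc⟩
  have hb : IsBoundaryArc K (c.arc t) (boundaryArc K (c.arc t)) := by
    rw [boundaryArc, dif_pos hex]; exact hex.choose_spec
  have h1 := c'.eq_of_isBoundaryArc hK hfr hb
  have h2 := c'.eq_of_isBoundaryArc hK hfr harc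
  constructor
  · change unitTangent (boundaryArc K (c.arc t)) 0 = _
    rw [h1.1, ← h2.1, unitTangent, unitTangent, velocity_comp_const_add]
    simp only [add_zero]
  · rw [boundaryCurvature, h1.2, ← h2.2, geodesicCurvature_comp_const_add]

end PlaneGeometry

namespace PlaneGeometry

variable {k : ℝ} {O p : Plane k} {K : Set (Plane k)}

/-! ### Closed curves -/

theorem continuousAt_curve {γ : ℝ → Plane k} {t : ℝ}
    (h : ContDiffAt ℝ 2 (fun s => (γ s).val) t) : ContinuousAt γ t :=
  (isInducing_val k).continuousAt_iff.2 h.continuousAt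

theorem continuousAt_length_velocity {γ : ℝ → Plane k} {t : ℝ}
    (h : ContDiffAt ℝ 2 (fun s => (γ s).val) t) :
    ContinuousAt (fun s => length k (velocity γ s)) t :=
  (continuous_length k).continuousAt.comp (contDiffAt_velocity h).continuousAt

theorem continuousAt_geodesicCurvature {γ : ℝ → Plane k} {t : ℝ}
    (h : ContDiffAt ℝ 2 (fun s => (γ s).val) t) (hv : velocity γ t ≠ 0) :
    ContinuousAt (geodesicCurvature γ) t := by
  have h1 : ContinuousAt (fun s => areaForm (γ s) (velocity γ s) (acceleration γ s)) t :=
    ContinuousAt.comp (f := fun s => (γ s, velocity γ s, acceleration γ s))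
      (continuous_areaForm k).continuousAt ((continuousAt_curve h).prodMk
        ((contDiffAt_velocity h).continuousAt.prodMk (continuousAt_acceleration h)))
  exact h1.div ((continuousAt_length_velocity h).pow 3)
    (pow_ne_zero 3 ((isTangent_velocity h).length_pos hv).ne')

theorem continuousAt_unitTangent {γ : ℝ → Plane k} {t : ℝ}
    (h : ContDiffAt ℝ 2 (fun s => (γ s).val) t) (hv : velocity γ t ≠ 0) :
    ContinuousAt (unitTangent γ) t :=
  ((continuousAt_length_velocity h).inv₀ ((isTangent_velocity h).length_pos hv).ne').smul
    (contDiffAt_velocity h).continuousAt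

theorem continuous_radius (O : Plane k) : Continuous fun p : Plane k => radius O p := by
  unfold radius; fun_prop

theorem continuous_areaForm_sub (O : Plane k) :
    Continuous fun x : Plane k × Ambient => areaForm O (x.1.val - O.val) x.2 := by
  have h1 : Continuous fun x : Plane k × Ambient => x.1.val :=
    (continuous_val k).comp continuous_fst
  simp only [areaForm_eq, det₃, Pi.sub_apply]
  fun_prop

/-- The integrand of the theorem, in a form that is visibly continuous. -/
theorem Frame.integrand_eq (F : Frame O) (p : Plane k) (κ : ℝ) (v : Ambient) :
    F.ell (radius O p) ^ 2 * κ * F.dTheta p v = κ * areaForm O (p.val - O.val) v := by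
  rw [← F.ell_sq_mul_dTheta]; ring

theorem Frame.continuousAt_integrand (F : Frame O) {γ : ℝ → Plane k} {t : ℝ}
    (h : ContDiffAt ℝ 2 (fun s => (γ s).val) t) (hv : velocity γ t ≠ 0) :
    ContinuousAt (fun t => F.ell (radius O (γ t)) ^ 2 * geodesicCurvature γ t *
      F.dTheta (γ t) (velocity γ t)) t := by
  simp only [F.integrand_eq]
  exact (continuousAt_geodesicCurvature h hv).mul
    (ContinuousAt.comp (f := fun s => (γ s, velocity γ s))
      (continuous_areaForm_sub O).continuousAt
      ((continuousAt_curve h).prodMk (contDiffAt_velocity h).continuousAt))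

theorem continuousAt_gcos_radius {γ : ℝ → Plane k} {t : ℝ} (O : Plane k)
    (h : ContDiffAt ℝ 2 (fun s => (γ s).val) t) :
    ContinuousAt (fun t => gcos k (radius O (γ t))) t :=
  ((continuous_gcos k).comp (continuous_radius O)).continuousAt.comp (continuousAt_curve h)

theorem Frame.length_closed_curve (F : Frame O) {γ : ℝ → Plane k} {b : ℝ}
    (hγ : ContDiff ℝ 2 (fun t => (γ t).val)) (hv : ∀ t, velocity γ t ≠ 0)
    (hper : Function.Periodic γ b) :
    IntervalIntegrable (fun t => F.ell (radius O (γ t)) ^ 2 *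
        geodesicCurvature γ t * F.dTheta (γ t) (velocity γ t)) volume 0 b ∧
      IntervalIntegrable (fun t => F.normArea (radius O (γ t)) *
        length k (velocity γ t)) volume 0 b ∧
      (∫ t in (0 : ℝ)..b, length k (velocity γ t)) =
        (∫ t in (0 : ℝ)..b, F.ell (radius O (γ t)) ^ 2 *
          geodesicCurvature γ t * F.dTheta (γ t) (velocity γ t)) +
        k * ∫ t in (0 : ℝ)..b, F.normArea (radius O (γ t)) *
          length k (velocity γ t) := by
  have c1 : Continuous fun t => F.ell (radius O (γ t)) ^ 2 *
      geodesicCurvature γ t * F.dTheta (γ t) (velocity γ t) :=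
    continuous_iff_continuousAt.2 fun t => F.continuousAt_integrand hγ.contDiffAt (hv t)
  have c2 : Continuous fun t => length k (velocity γ t) :=
    continuous_iff_continuousAt.2 fun t => continuousAt_length_velocity hγ.contDiffAt
  have c3 : Continuous fun t => F.normArea (radius O (γ t)) :=
    F.continuous_normArea_radius.comp
      (continuous_iff_continuousAt.2 fun t => continuousAt_curve hγ.contDiffAt)
  have i1 := c1.intervalIntegrable (μ := volume) 0 b
  have i2 := c2.intervalIntegrable (μ := volume) 0 b
  have i3 : IntervalIntegrable (fun t => F.normArea (radius O (γ t)) * length k (velocity γ t))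
      volume 0 b := (c3.mul c2).intervalIntegrable 0 b
  refine ⟨i1, i3, ?_⟩
  have hd := intervalIntegral.integral_eq_sub_of_hasDerivAt
    (fun t (_ : t ∈ uIcc 0 b) => F.hasDerivAt_form_div_length hγ.contDiffAt (hv t))
    ((((continuous_gcos k).comp ((continuous_radius O).comp
      (continuous_iff_continuousAt.2 fun t => continuousAt_curve hγ.contDiffAt))).mul c2 |>.sub
        c1).intervalIntegrable 0 b)
  have hvp : velocity γ b = velocity γ 0 := by
    have h1 : (fun s => γ (b + s)) = γ := funext fun s => by rw [add_comm]; exact hper s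
    have h2 := velocity_comp_const_add γ b
    rw [h1] at h2
    simpa using (congrFun h2 0).symm
  have hγp : γ b = γ 0 := by simpa using hper 0
  -- Position and velocity are periodic, so the endpoint values of `⟨X, T⟩` cancel.
  rw [hvp, hγp, sub_self] at hd
  have e : (∫ t in (0 : ℝ)..b, (length k (velocity γ t)
        - k * (F.normArea (radius O (γ t)) * length k (velocity γ t))
        - F.ell (radius O (γ t)) ^ 2 * geodesicCurvature γ t *
          F.dTheta (γ t) (velocity γ t))) = 0 := by
    rw [← hd]
    congr 1
    funext t
    rw [← F.one_sub_normArea_radius]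
    ring
  rw [intervalIntegral.integral_sub (i2.sub (i3.const_mul k)) i1,
    intervalIntegral.integral_sub i2 (i3.const_mul k), intervalIntegral.integral_const_mul] at e
  linarith

/-! ### Integration along the boundary of a region -/

theorem BoundaryChart.injOn_arc (c : BoundaryChart K p) : InjOn c.arc (Icc (-c.δ) c.δ) :=
  fun s hs t ht h => by rw [← c.coord s hs, ← c.coord t ht, h]

theorem BoundaryChart.continuousOn_arc (c : BoundaryChart K p) :
    ContinuousOn c.arc (Icc (-c.δ) c.δ) := fun t ht =>
  (continuousAt_curve (c.contDiffAt t ht)).continuousWithinAt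

theorem BoundaryChart.continuousOn_speed (c : BoundaryChart K p) :
    ContinuousOn (fun t => length k (velocity c.arc t)) (Icc (-c.δ) c.δ) := fun t ht =>
  (continuousAt_length_velocity (c.contDiffAt t ht)).continuousWithinAt

theorem BoundaryChart.speed_pos (c : BoundaryChart K p) {t : ℝ} (ht : t ∈ Icc (-c.δ) c.δ) :
    0 < length k (velocity c.arc t) :=
  (isTangent_velocity (c.contDiffAt t ht)).length_pos (c.velocity_ne_zero t ht)

theorem BoundaryChart.tendsto_dist_div (c : BoundaryChart K p) {t : ℝ}
    (ht : t ∈ Icc (-c.δ) c.δ) :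
    Tendsto (fun x : ℝ × ℝ => dist (c.arc x.1) (c.arc x.2) / |x.1 - x.2|)
      (𝓝 (t, t) ⊓ 𝓟 {x | x.1 ≠ x.2}) (𝓝 (length k (velocity c.arc t))) :=
  PlaneGeometry.tendsto_dist_div ((c.contDiffAt t ht).hasStrictDerivAt two_ne_zero)

theorem BoundaryChart.arcLength_lt_top (c : BoundaryChart K p) :
    arcLength k (frontier K ∩ Plane.val ⁻¹' c.nbhd) < ⊤ := by
  rw [← c.image_eq, arcLength, hausdorffMeasure_image_eq_lintegral
    (c.continuousOn_arc.mono Ioo_subset_Icc_self) (c.injOn_arc.mono Ioo_subset_Icc_self)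
    (c.continuousOn_speed.mono Ioo_subset_Icc_self)
    (fun t ht => c.speed_pos (Ioo_subset_Icc_self ht))
    (fun t ht => c.tendsto_dist_div (Ioo_subset_Icc_self ht)) Subset.rfl measurableSet_Ioo]
  have := (c.continuousOn_speed.integrableOn_Icc (μ := volume)).mono_set Ioo_subset_Icc_self
  exact this.lintegral_lt_top

theorem BoundaryChart.setIntegral_eq (c : BoundaryChart K p) {φ : Plane k → ℝ}
    (hφ : AEStronglyMeasurable φ ((arcLength k).restrict (frontier K))) :
    ∫ q in frontier K ∩ Plane.val ⁻¹' c.nbhd, φ q ∂arcLength k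
      = ∫ t in Ioo (-c.δ) c.δ, length k (velocity c.arc t) * φ (c.arc t) := by
  have hsub : c.arc '' Ioo (-c.δ) c.δ ⊆ frontier K := by
    rw [c.image_eq]; exact inter_subset_left
  rw [← c.image_eq]
  exact setIntegral_hausdorffMeasure_image measurableSet_Ioo
    (c.continuousOn_arc.mono Ioo_subset_Icc_self) (c.injOn_arc.mono Ioo_subset_Icc_self)
    (c.continuousOn_speed.mono Ioo_subset_Icc_self)
    (fun t ht => c.speed_pos (Ioo_subset_Icc_self ht))
    (fun t ht => c.tendsto_dist_div (Ioo_subset_Icc_self ht)) (hφ.mono_set hsub)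

theorem arcLength_frontier_lt_top (hK : IsCompact K) (hC : HasC2Boundary K) :
    arcLength k (frontier K) < ⊤ := by
  have hfr : IsCompact (frontier K) :=
    hK.of_isClosed_subset isClosed_frontier hK.isClosed.frontier_subset
  refine hfr.measure_lt_top_of_nhdsWithin fun p hp => ?_
  obtain ⟨c⟩ := nonempty_boundaryChart hK.isClosed hC hp
  exact ⟨_, inter_mem_nhdsWithin _
    ((c.isOpen_nbhd.preimage (continuous_val k)).mem_nhds c.mem_nbhd), c.arcLength_lt_top⟩

/-- The chart coordinate is a continuous inverse of the arc, so continuity at `p` along the frontier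
can be tested on the parameter. This is how the pointwise choices in `boundaryTangent` and
`boundaryCurvature` are seen to give continuous functions. -/
theorem BoundaryChart.continuousWithinAt (c : BoundaryChart K p) (hp : p ∈ frontier K)
    {Y : Type*} [TopologicalSpace Y] {φ : Plane k → Y} {h : ℝ → Y} (hh : ContinuousAt h 0)
    (heq : ∀ t ∈ Ioo (-c.δ) c.δ, φ (c.arc t) = h t) :
    ContinuousWithinAt φ (frontier K) p := by
  have hco : Continuous fun q : Plane k => form k (q.val - p.val) c.dir := by
    have h1 : Continuous fun x : Ambient => form k (x - p.val) c.dir := by unfold form; fun_prop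
    exact h1.comp (continuous_val k)
  have hp0 : form k (p.val - p.val) c.dir = 0 := by simp [form_def]
  have h1 : ContinuousAt (fun q : Plane k => h (form k (q.val - p.val) c.dir)) p :=
    ContinuousAt.comp (f := fun q : Plane k => form k (q.val - p.val) c.dir)
      (by rw [hp0]; exact hh) hco.continuousAt
  have hφ : ∀ q ∈ frontier K, q.val ∈ c.nbhd → φ q = h (form k (q.val - p.val) c.dir) := by
    intro q hq hq'
    obtain ⟨h2, h3⟩ := c.arc_coord hq hq'
    rw [← heq _ h2, h3]
  refine h1.continuousWithinAt.congr_of_eventuallyEq ?_ (hφ p hp c.mem_nbhd)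
  filter_upwards [self_mem_nhdsWithin, mem_nhdsWithin_of_mem_nhds
    ((c.isOpen_nbhd.preimage (continuous_val k)).mem_nhds c.mem_nbhd)] with q hq hq'
  exact hφ q hq hq'

theorem BoundaryChart.zero_mem (c : BoundaryChart K p) : (0 : ℝ) ∈ Icc (-c.δ) c.δ :=
  ⟨by linarith [c.δ_pos], c.δ_pos.le⟩

theorem BoundaryChart.zero_mem_Ioo (c : BoundaryChart K p) : (0 : ℝ) ∈ Ioo (-c.δ) c.δ :=
  ⟨by linarith [c.δ_pos], c.δ_pos⟩

theorem continuousOn_boundaryTangent (hK : IsClosed K) (hC : HasC2Boundary K) :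
    ContinuousOn (boundaryTangent K) (frontier K) := by
  intro p hp
  obtain ⟨c⟩ := nonempty_boundaryChart hK hC hp
  exact c.continuousWithinAt hp (continuousAt_unitTangent (c.contDiffAt 0 c.zero_mem)
    (c.velocity_ne_zero 0 c.zero_mem)) fun t ht => (c.boundary_eq hK hC ht).1

theorem continuousOn_boundaryCurvature (hK : IsClosed K) (hC : HasC2Boundary K) :
    ContinuousOn (boundaryCurvature K) (frontier K) := by
  intro p hp
  obtain ⟨c⟩ := nonempty_boundaryChart hK hC hp
  exact c.continuousWithinAt hp (continuousAt_geodesicCurvature (c.contDiffAt 0 c.zero_mem)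
    (c.velocity_ne_zero 0 c.zero_mem)) fun t ht => (c.boundary_eq hK hC ht).2

theorem integrableOn_frontier (hK : IsCompact K) (hC : HasC2Boundary K) {φ : Plane k → ℝ}
    (hφ : ContinuousOn φ (frontier K)) : IntegrableOn φ (frontier K) (arcLength k) := by
  have hfr : IsCompact (frontier K) :=
    hK.of_isClosed_subset isClosed_frontier hK.isClosed.frontier_subset
  have : IsFiniteMeasure ((arcLength k).restrict (frontier K)) :=
    ⟨by simpa using arcLength_frontier_lt_top hK hC⟩
  have h := hφ.integrableOn_compact (μ := (arcLength k).restrict (frontier K)) hfr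
  rwa [IntegrableOn, Measure.restrict_restrict isClosed_frontier.measurableSet, inter_self] at h

theorem Frame.continuousOn_boundary_integrand (F : Frame O) (hK : IsClosed K)
    (hC : HasC2Boundary K) :
    ContinuousOn (fun p => F.ell (radius O p) ^ 2 * boundaryCurvature K p *
      F.dTheta p (boundaryTangent K p)) (frontier K) := by
  have h : ContinuousOn (fun p => areaForm O (p.val - O.val) (boundaryTangent K p))
      (frontier K) := by
    have h1 := (continuous_val k).continuousOn (s := frontier K)
    have h2 := continuousOn_boundaryTangent hK hC
    simp only [areaForm_eq, det₃, Pi.sub_apply]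
    fun_prop
  refine ((continuousOn_boundaryCurvature hK hC).mul h).congr fun p _ => ?_
  exact F.integrand_eq p _ _

/-- The local form of the divergence theorem: the derivative along the boundary of a function
with support in a chart has integral zero. -/
theorem BoundaryChart.setIntegral_eq_zero (c : BoundaryChart K p) (F : Frame O)
    (hK : IsCompact K) (hC : HasC2Boundary K) {χ : Ambient → ℝ} (hχ : ContDiff ℝ 1 χ)
    (hsupp : tsupport χ ⊆ c.nbhd) :
    IntegrableOn (fun q => fderiv ℝ χ q.val (boundaryTangent K q) *
        form k (q.val - O.val) (boundaryTangent K q) + χ q.val * (gcos k (radius O q) -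
        F.ell (radius O q) ^ 2 * boundaryCurvature K q * F.dTheta q (boundaryTangent K q)))
      (frontier K) (arcLength k) ∧
    ∫ q in frontier K, (fderiv ℝ χ q.val (boundaryTangent K q) *
        form k (q.val - O.val) (boundaryTangent K q) + χ q.val * (gcos k (radius O q) -
        F.ell (radius O q) ^ 2 * boundaryCurvature K q * F.dTheta q (boundaryTangent K q)))
      ∂arcLength k = 0 := by
  have hT := continuousOn_boundaryTangent hK.isClosed hC
  have hv := (continuous_val k).continuousOn (s := frontier K)
  have hcont : ContinuousOn (fun q => fderiv ℝ χ q.val (boundaryTangent K q) *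
        form k (q.val - O.val) (boundaryTangent K q) + χ q.val * (gcos k (radius O q) -
        F.ell (radius O q) ^ 2 * boundaryCurvature K q * F.dTheta q (boundaryTangent K q)))
      (frontier K) := by
    refine ((((hχ.continuous_fderiv one_ne_zero).comp_continuousOn hv).clm_apply hT).mul
      ((continuous_form k).comp_continuousOn ((hv.sub continuousOn_const).prodMk hT))).add
      ((hχ.continuous.comp_continuousOn hv).mul (ContinuousOn.sub ?_
        (F.continuousOn_boundary_integrand hK.isClosed hC)))
    exact ((continuous_gcos k).comp (continuous_radius O)).continuousOn
  have hint := integrableOn_frontier hK hC hcont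
  refine ⟨hint, ?_⟩
  -- Off the chart both `χ` and its differential vanish, so the integral becomes one over the
  -- parameter interval.
  rw [setIntegral_eq_of_subset_of_forall_sdiff_eq_zero isClosed_frontier.measurableSet
    (inter_subset_left (t := Plane.val ⁻¹' c.nbhd)), c.setIntegral_eq hint.aestronglyMeasurable]
  · set Q : ℝ → ℝ := fun t => form k ((c.arc t).val - O.val) (velocity c.arc t) /
      length k (velocity c.arc t)
    set G : ℝ → ℝ := fun t => gcos k (radius O (c.arc t)) * length k (velocity c.arc t) -
      F.ell (radius O (c.arc t)) ^ 2 * geodesicCurvature c.arc t *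
        F.dTheta (c.arc t) (velocity c.arc t)
    have hQ : ∀ t ∈ Icc (-c.δ) c.δ, HasDerivAt Q (G t) t := fun t ht =>
      F.hasDerivAt_form_div_length (c.contDiffAt t ht) (c.velocity_ne_zero t ht)
    have hχd : ∀ t ∈ Icc (-c.δ) c.δ, HasDerivAt (fun t => χ (c.arc t).val)
        (fderiv ℝ χ (c.arc t).val (velocity c.arc t)) t := fun t ht =>
      (hχ.differentiable one_ne_zero _).hasFDerivAt.comp_hasDerivAt t
        (hasDerivAt_velocity_of (c.contDiffAt t ht))
    have hGc : ContinuousOn G (Icc (-c.δ) c.δ) := fun t ht =>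
      (((continuousAt_gcos_radius O (c.contDiffAt t ht)).mul
        (continuousAt_length_velocity (c.contDiffAt t ht))).sub
        (F.continuousAt_integrand (c.contDiffAt t ht)
          (c.velocity_ne_zero t ht))).continuousWithinAt
    have hχc : ContinuousOn (fun t => fderiv ℝ χ (c.arc t).val (velocity c.arc t))
        (Icc (-c.δ) c.δ) := fun t ht =>
      (ContinuousAt.clm_apply (ContinuousAt.comp (f := fun t => (c.arc t).val)
        (hχ.continuous_fderiv one_ne_zero).continuousAt (c.contDiffAt t ht).continuousAt)
        (contDiffAt_velocity (c.contDiffAt t ht)).continuousAt).continuousWithinAt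
    have hle : -c.δ ≤ c.δ := by linarith [c.δ_pos]
    have hftc := intervalIntegral.integral_eq_sub_of_hasDerivAt (a := -c.δ) (b := c.δ)
      (f := fun t => χ (c.arc t).val * Q t)
      (fun t ht => (hχd t (uIcc_of_le hle ▸ ht)).mul (hQ t (uIcc_of_le hle ▸ ht)))
      (ContinuousOn.intervalIntegrable (by
        rw [uIcc_of_le hle]
        exact (hχc.mul fun t ht => (hQ t ht).continuousAt.continuousWithinAt).add
          (ContinuousOn.mul (fun t ht => (hχd t ht).continuousAt.continuousWithinAt) hGc)))
    -- The endpoints of the arc lie outside the neighbourhood, so both boundary terms of the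
    -- fundamental theorem of calculus vanish.
    have h0 : ∀ x, x ∉ c.nbhd → χ x = 0 := fun x hx =>
      image_eq_zero_of_notMem_tsupport fun h => hx (hsupp h)
    rw [h0 _ c.left_notMem, h0 _ c.right_notMem, zero_mul, zero_mul, sub_zero,
      intervalIntegral.integral_of_le hle, integral_Ioc_eq_integral_Ioo] at hftc
    rw [← hftc]
    refine setIntegral_congr_fun measurableSet_Ioo fun t ht => ?_
    have hL := c.speed_pos (Ioo_subset_Icc_self ht)
    obtain ⟨e1, e2⟩ := c.boundary_eq hK.isClosed hC ht
    simp only [e1, e2, F.integrand_eq, G, Q, unitTangent, map_smul, smul_eq_mul, form_smul_right,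
      areaForm_smul_right]
    field_simp
  · rintro q ⟨hq, hq'⟩
    have hq'' : q.val ∉ tsupport χ := fun h => hq' ⟨hq, hsupp h⟩
    have h1 : χ q.val = 0 := image_eq_zero_of_notMem_tsupport hq''
    have h2 : fderiv ℝ χ q.val = 0 :=
      image_eq_zero_of_notMem_tsupport fun h => hq'' (tsupport_fderiv_subset ℝ h)
    simp [h1, h2]

end PlaneGeometry

/-! ### Partition of unity and the perimeter formula -/

namespace PlaneGeometry

variable {k : ℝ} {O p : Plane k} {K : Set (Plane k)}

/-- A finite family of smooth functions, each supported in a boundary chart, that sum to `1` on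
the boundary. -/
theorem exists_partition_frontier (hK : IsCompact K) (hC : HasC2Boundary K) :
    ∃ (ι : Type) (_ : Fintype ι) (χ : ι → Ambient → ℝ), (∀ i, ContDiff ℝ 1 (χ i)) ∧
      (∀ i, ∃ p, ∃ c : BoundaryChart K p, tsupport (χ i) ⊆ c.nbhd) ∧
      ∀ q ∈ frontier K, ∑ i, χ i q.val = 1 := by
  have hfr : IsCompact (frontier K) :=
    hK.of_isClosed_subset isClosed_frontier hK.isClosed.frontier_subset
  let c := fun p : frontier K => (nonempty_boundaryChart hK.isClosed hC p.2).some
  obtain ⟨S, hS⟩ := hfr.elim_finite_subcover (fun p => Plane.val ⁻¹' (c p).nbhd)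
    (fun p => (c p).isOpen_nbhd.preimage (continuous_val k))
    fun q hq => mem_iUnion.2 ⟨⟨q, hq⟩, (c ⟨q, hq⟩).mem_nbhd⟩
  obtain ⟨χ, hχ⟩ := SmoothPartitionOfUnity.exists_isSubordinate
    (modelWithCornersSelf ℝ Ambient) (hfr.image (continuous_val k)).isClosed
    (fun i : S => (c i).nbhd) (fun i => (c i).isOpen_nbhd) (by
      rintro _ ⟨q, hq, rfl⟩
      obtain ⟨i, hi, hqi⟩ := mem_iUnion₂.1 (hS hq)
      exact mem_iUnion.2 ⟨⟨i, hi⟩, hqi⟩)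
  refine ⟨S, inferInstance, fun i => χ i, fun i => ?_, fun i => ⟨_, c i, hχ i⟩, fun q hq => ?_⟩
  · exact (contMDiff_iff_contDiff.1 (χ i).contMDiff).of_le (by simp)
  · rw [← χ.sum_eq_one (mem_image_of_mem _ hq), finsum_eq_sum_of_fintype]

/-- The sum is `1` only on the frontier, so only its derivative along the boundary is known to
vanish; it is computed along a chart arc. -/
theorem sum_fderiv_boundaryTangent_eq_zero (hK : IsClosed K) (hC : HasC2Boundary K) {ι : Type*}
    [Fintype ι] {χ : ι → Ambient → ℝ} (hχ : ∀ i, ContDiff ℝ 1 (χ i))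
    (hsum : ∀ q ∈ frontier K, ∑ i, χ i q.val = 1) (hp : p ∈ frontier K) :
    ∑ i, fderiv ℝ (χ i) p.val (boundaryTangent K p) = 0 := by
  obtain ⟨c⟩ := nonempty_boundaryChart hK hC hp
  have h0 := c.arc_zero hp
  have h1 : HasDerivAt (fun t => ∑ i, χ i (c.arc t).val)
      (∑ i, fderiv ℝ (χ i) (c.arc 0).val (velocity c.arc 0)) 0 :=
    HasDerivAt.fun_sum fun i _ => ((hχ i).differentiable one_ne_zero _).hasFDerivAt.comp_hasDerivAt
      (0 : ℝ) (hasDerivAt_velocity_of (c.contDiffAt 0 c.zero_mem))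
  have h2 : (fun _ : ℝ => (1 : ℝ)) =ᶠ[𝓝 0] fun t => ∑ i, χ i (c.arc t).val := by
    filter_upwards [isOpen_Ioo.mem_nhds c.zero_mem_Ioo] with t ht
    exact (hsum _ (c.arc_mem ht).1).symm
  have h3 := (h1.congr_of_eventuallyEq h2).unique (hasDerivAt_const 0 1)
  have h4 := (c.boundary_eq hK hC c.zero_mem_Ioo).1
  rw [h0] at h3 h4
  rw [h4]
  simp only [unitTangent, map_smul, smul_eq_mul, ← Finset.mul_sum, h3, mul_zero]

/-- The Minkowski-type formula on the boundary of a region. -/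
theorem Frame.setIntegral_frontier_eq_zero (F : Frame O) (hK : IsCompact K)
    (hC : HasC2Boundary K) :
    ∫ q in frontier K, (gcos k (radius O q) -
      F.ell (radius O q) ^ 2 * boundaryCurvature K q * F.dTheta q (boundaryTangent K q))
      ∂arcLength k = 0 := by
  obtain ⟨ι, _, χ, hχ, hsupp, hsum⟩ := exists_partition_frontier hK hC
  choose p c hc using hsupp
  have key := fun i => (c i).setIntegral_eq_zero F hK hC (hχ i) (hc i)
  have h := integral_finsetSum Finset.univ fun i _ => (key i).1
  rw [Finset.sum_eq_zero fun i _ => (key i).2] at h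
  rw [← h]
  -- After summation the terms with derivatives of the cutoffs cancel and the cutoffs themselves add
  -- up to `1`.
  refine setIntegral_congr_fun isClosed_frontier.measurableSet fun q hq => ?_
  simp only [Finset.sum_add_distrib, ← Finset.sum_mul, hsum q hq,
    sum_fderiv_boundaryTangent_eq_zero hK.isClosed hC hχ hsum hq, zero_mul, one_mul, zero_add]

theorem Frame.perimeter_eq (F : Frame O) (hK : IsCompact K) (hC : HasC2Boundary K) :
    arcLength k (frontier K) ≠ ⊤ ∧
      IntegrableOn (fun p => F.ell (radius O p) ^ 2 *
        boundaryCurvature K p * F.dTheta p (boundaryTangent K p))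
        (frontier K) (arcLength k) ∧
      IntegrableOn (fun p => F.normArea (radius O p))
        (frontier K) (arcLength k) ∧
      (arcLength k (frontier K)).toReal =
        (∫ p in frontier K, F.ell (radius O p) ^ 2 *
          boundaryCurvature K p * F.dTheta p (boundaryTangent K p)
          ∂arcLength k) +
        k * ∫ p in frontier K, F.normArea (radius O p) ∂arcLength k := by
  have i1 := integrableOn_frontier hK hC (F.continuousOn_boundary_integrand hK.isClosed hC)
  have i2 := integrableOn_frontier hK hC F.continuous_normArea_radius.continuousOn
  have i3 : IntegrableOn (fun _ => (1 : ℝ)) (frontier K) (arcLength k) :=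
    integrableOn_frontier hK hC continuousOn_const
  refine ⟨(arcLength_frontier_lt_top hK hC).ne, i1, i2, ?_⟩
  have h := F.setIntegral_frontier_eq_zero hK hC
  simp only [← F.one_sub_normArea_radius] at h
  have i4 : IntegrableOn (fun p => 1 - k * F.normArea (radius O p)) (frontier K) (arcLength k) :=
    i3.sub (i2.const_mul k)
  rw [integral_sub i4 i1, integral_sub i3 (i2.const_mul k), integral_const_mul,
    setIntegral_const, smul_eq_mul, mul_one, measureReal_def] at h
  linarith

end PlaneGeometry

theorem theorem2p1 (k : ℝ) (O : Plane k) (F : Frame O) :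
    -- the perimeter of a compact region with `C²` boundary; along the boundary `dθ = dθ(T) ds`
    (∀ K : Set (Plane k), IsCompact K → HasC2Boundary K →
      arcLength k (frontier K) ≠ ⊤ ∧
      IntegrableOn (fun p => F.ell (radius O p) ^ 2 *
        boundaryCurvature K p * F.dTheta p (boundaryTangent K p))
        (frontier K) (arcLength k) ∧
      IntegrableOn (fun p => F.normArea (radius O p))
        (frontier K) (arcLength k) ∧
      (arcLength k (frontier K)).toReal =
        (∫ p in frontier K, F.ell (radius O p) ^ 2 *
          boundaryCurvature K p * F.dTheta p (boundaryTangent K p)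
          ∂arcLength k) +
        k * ∫ p in frontier K, F.normArea (radius O p) ∂arcLength k) ∧
    -- the length of a closed `C²` curve, not necessarily simple
    (∀ (γ : ℝ → Plane k) (b : ℝ), 0 < b → ContDiff ℝ 2 (fun t => (γ t).val) →
      (∀ t, velocity γ t ≠ 0) → Function.Periodic γ b →
      IntervalIntegrable (fun t => F.ell (radius O (γ t)) ^ 2 *
        geodesicCurvature γ t * F.dTheta (γ t) (velocity γ t))
        volume 0 b ∧
      IntervalIntegrable (fun t => F.normArea (radius O (γ t)) *
        length k (velocity γ t)) volume 0 b ∧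
      (∫ t in (0 : ℝ)..b, length k (velocity γ t)) =
        (∫ t in (0 : ℝ)..b, F.ell (radius O (γ t)) ^ 2 *
          geodesicCurvature γ t * F.dTheta (γ t) (velocity γ t)) +
        k * ∫ t in (0 : ℝ)..b, F.normArea (radius O (γ t)) *
          length k (velocity γ t)) := by
  exact ⟨fun K hK hC => F.perimeter_eq hK hC,
    fun γ b _ hγ hv hper => F.length_closed_curve hγ hv hper⟩
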